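/- Let $n\ge 1$, let $\Omega\subset\mathbb{R}^n$ be an open set and let $\mathbb{V}$ be a nonnegative Radon measure in $\Omega$ (a Borel measure, finite on compact subsets of $\Omega$) that is absolutely continuous with respect to the Wiener capacity: $\mathbb{V}(E)=0$ for every Borel set $E\subset\Omega$ of zero capacity. Here, for a bounded open set $G$ and a compact set $F\subset G$, $$\mathrm{cap}_G F=\inf\Bigl\{\int_G|\nabla u|^2\,dx:\ u\in C_0^\infty(G),\ u\ge 1\text{ on }F\Bigr\},$$ $\mathrm{cap}_G E=\sup\{\mathrm{cap}_G F: F\subset E \text{ compact}\}$ for Borel $E\subset G$, and a Borel set $E\subset\mathbb{R}^n$ has zero capacity if $\mathrm{cap}_G(E\cap G)=0$ for every bounded open set $G\subset\mathbb{R}^n$. Let $H_{\mathbb{V}}=-\Delta+\mathbb{V}$ be the operator in $L_2(\Omega)$ (complex-valued functions) associated with the closure of the quadratic form $$Q[u,u]=\int_\Omega|\nabla u|^2\,dx+\int_\Omega|u|^2\,\mathbb{V}(dx),\qquad u\in C_0^\infty(\Omega).$$ The discrete spectrum of $H_{\mathbb{V}}$ is the set of isolated points of its spectrum that are eigenvalues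 of finite multiplicity; the essential spectrum is the rest of the spectrum; the spectrum is purely discrete if it coincides with the discrete spectrum. If the spectrum of $H_{\mathbb{V}}$ is not purely discrete, then the essential spectrum of $H_{\mathbb{V}}$ extends to infinity, i.e. for every $M\in\mathbb{R}$ it contains a real number greater than $M$. Moreover, if $0$ belongs to the essential spectrum of $H_{\mathbb{V}}$, then the essential spectrum coincides with $[0,\infty)$. -/

import Mathlib

open MeasureTheory Filter Topology
open scoped ContDiff ComplexConjugate

noncomputable section

namespace Schrodinger

/-! ### Spectra of unbounded operators -/

section Spectrum

variable {H : Type*} [NormedAddCommGroup H] [InnerProductSpace ℂ H]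

/-- The resolvent set of an unbounded operator `T`: the numbers `z` for which `T - z`, from the
domain of `T` to the whole space, has an everywhere defined bounded inverse `R`. -/
def resolventSet (T : H →ₗ.[ℂ] H) : Set ℂ :=
  {z | ∃ R : H →L[ℂ] H,
    (∀ y : H, ∃ x : T.domain, (x : H) = R y ∧ T x - z • (x : H) = y) ∧
    ∀ x : T.domain, R (T x - z • (x : H)) = x}

/-- The spectrum of an unbounded operator. -/
def spectrum (T : H →ₗ.[ℂ] H) : Set ℂ := (resolventSet T)ᶜ

/-- The eigenspace `ker (T - z)`, as a subspace of the whole space. -/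
def eigenspace (T : H →ₗ.[ℂ] H) (z : ℂ) : Submodule ℂ H :=
  (LinearMap.ker (T.toFun - z • T.domain.subtype)).map T.domain.subtype

/-- The discrete spectrum: the isolated points of the spectrum that are eigenvalues of finite
multiplicity. -/
def discreteSpectrum (T : H →ₗ.[ℂ] H) : Set ℂ :=
  {z | z ∈ spectrum T ∧ (∃ ε > 0, ∀ w ∈ spectrum T, dist w z < ε → w = z) ∧
    eigenspace T z ≠ ⊥ ∧ FiniteDimensional ℂ (eigenspace T z)}

/-- The essential spectrum: the part of the spectrum outside the discrete spectrum. -/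
def essentialSpectrum (T : H →ₗ.[ℂ] H) : Set ℂ := spectrum T \ discreteSpectrum T

/-- The spectrum is purely discrete if it consists of isolated eigenvalues of finite
multiplicity. -/
def HasPurelyDiscreteSpectrum (T : H →ₗ.[ℂ] H) : Prop := spectrum T ⊆ discreteSpectrum T

end Spectrum

/-! ### Wiener capacity -/

section Capacity

variable {n : ℕ}

/-- The Wiener capacity of a compact set `F` with respect to an open set `G ⊇ F`: the infimum of
`∫_G |∇u|²` over the real functions `u ∈ C₀^∞(G)` with `u ≥ 1` on `F`. -/
def compactCapacity (G F : Set (EuclideanSpace ℝ (Fin n))) : ENNReal :=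
  ⨅ (u : EuclideanSpace ℝ (Fin n) → ℝ) (_ : ContDiff ℝ ∞ u) (_ : HasCompactSupport u)
    (_ : tsupport u ⊆ G) (_ : ∀ x ∈ F, 1 ≤ u x), ∫⁻ x in G, ‖gradient u x‖ₑ ^ 2

/-- The Wiener capacity of a Borel set `E ⊆ G` with respect to the open set `G`: the supremum of
the capacities of the compact subsets of `E`. -/
def capacity (G E : Set (EuclideanSpace ℝ (Fin n))) : ENNReal :=
  ⨆ (F : Set (EuclideanSpace ℝ (Fin n))) (_ : IsCompact F) (_ : F ⊆ E), compactCapacity G F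

/-- `E` has zero capacity: the part of `E` in any bounded open set `G` has zero capacity with
respect to `G`. (Capacities with respect to unbounded open sets are smaller; in dimensions one and
two, those with respect to the whole space vanish identically and do not detect null sets.) -/
def HasZeroCapacity (E : Set (EuclideanSpace ℝ (Fin n))) : Prop :=
  ∀ G : Set (EuclideanSpace ℝ (Fin n)), IsOpen G → Bornology.IsBounded G → capacity G (E ∩ G) = 0

/-- `V` is, on `Ω`, absolutely continuous with respect to the capacity. -/
def AbsContCapacity (Ω : Set (EuclideanSpace ℝ (Fin n)))
    (V : Measure (EuclideanSpace ℝ (Fin n))) : Prop :=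
  ∀ E ⊆ Ω, MeasurableSet E → HasZeroCapacity E → V E = 0

/-- `V` is a Radon measure in `Ω`: it is finite on the compact subsets of `Ω` (its values outside
`Ω` are never used). -/
def IsRadonIn (Ω : Set (EuclideanSpace ℝ (Fin n)))
    (V : Measure (EuclideanSpace ℝ (Fin n))) : Prop :=
  ∀ K ⊆ Ω, IsCompact K → V K < ⊤

end Capacity

/-! ### The form and its closure -/

section Form

variable {n : ℕ}

/-- The Hilbert space `L₂(Ω)` of complex-valued functions, for Lebesgue measure on `Ω`. -/
abbrev L2 (Ω : Set (EuclideanSpace ℝ (Fin n))) : Type := Lp ℂ 2 (volume.restrict Ω)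

/-- The space `C₀^∞(Ω)` of complex-valued smooth functions with compact support in `Ω`. -/
def testSpace (Ω : Set (EuclideanSpace ℝ (Fin n))) :
    Submodule ℂ (EuclideanSpace ℝ (Fin n) → ℂ) where
  carrier := {φ | ContDiff ℝ ∞ φ ∧ HasCompactSupport φ ∧ tsupport φ ⊆ Ω}
  zero_mem' := ⟨contDiff_const, HasCompactSupport.zero, by
    rw [tsupport_eq_empty_iff.mpr rfl]; exact Set.empty_subset _⟩
  add_mem' := fun {a b} ha hb => ⟨ha.1.add hb.1, ha.2.1.add hb.2.1,
    (tsupport_add a b).trans (Set.union_subset ha.2.2 hb.2.2)⟩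
  smul_mem' := fun c a ha => ⟨contDiff_const.smul ha.1, ha.2.1.smul_left (f := fun _ => c),
    (tsupport_smul_subset_right (fun _ => c) a).trans ha.2.2⟩

/-- The partial derivative `∂φ/∂x_k`. -/
def partialDeriv (k : Fin n) (φ : EuclideanSpace ℝ (Fin n) → ℂ)
    (x : EuclideanSpace ℝ (Fin n)) : ℂ :=
  fderiv ℝ φ x (EuclideanSpace.single k 1)

/-- The sesquilinear form `Q[φ, ψ] = ∫_Ω ∇φ · conj ∇ψ dx + ∫_Ω φ conj ψ dV`. -/
def form (Ω : Set (EuclideanSpace ℝ (Fin n))) (V : Measure (EuclideanSpace ℝ (Fin n)))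
    (φ ψ : EuclideanSpace ℝ (Fin n) → ℂ) : ℂ :=
  (∑ k : Fin n, ∫ x in Ω, partialDeriv k φ x * conj (partialDeriv k ψ x)) +
    ∫ x in Ω, φ x * conj (ψ x) ∂V

/-- The sequence `φ` in `C₀^∞(Ω)` is a Cauchy sequence for `Q` and converges to `u` in `L₂(Ω)`.
The domain of the closure of `Q` consists of the `u` that have such a sequence. -/
structure FormApprox (Ω : Set (EuclideanSpace ℝ (Fin n)))
    (V : Measure (EuclideanSpace ℝ (Fin n)))
    (φ : ℕ → EuclideanSpace ℝ (Fin n) → ℂ) (u : L2 Ω) : Prop where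
  mem : ∀ j, φ j ∈ testSpace Ω
  cauchy : Tendsto (fun p : ℕ × ℕ => (form Ω V (φ p.1 - φ p.2) (φ p.1 - φ p.2)).re) atTop (𝓝 0)
  tendsto : Tendsto (fun j => eLpNorm (φ j - ⇑u) 2 (volume.restrict Ω)) atTop (𝓝 0)

variable {Ω : Set (EuclideanSpace ℝ (Fin n))} {V : Measure (EuclideanSpace ℝ (Fin n))}

lemma partialDeriv_add {a b : EuclideanSpace ℝ (Fin n) → ℂ} (ha : a ∈ testSpace Ω)
    (hb : b ∈ testSpace Ω) (k : Fin n) :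
    partialDeriv k (a + b) = partialDeriv k a + partialDeriv k b := by
  funext x
  simp only [partialDeriv, Pi.add_apply]
  rw [fderiv_add (ha.1.differentiable (by simp) x) (hb.1.differentiable (by simp) x)]
  rfl

lemma partialDeriv_smul {a : EuclideanSpace ℝ (Fin n) → ℂ} (ha : a ∈ testSpace Ω) (c : ℂ)
    (k : Fin n) : partialDeriv k (c • a) = c • partialDeriv k a := by
  funext x
  simp only [partialDeriv, Pi.smul_apply]
  rw [fderiv_const_smul (ha.1.differentiable (by simp) x)]
  rfl

lemma integrable_partialDeriv_mul {a b : EuclideanSpace ℝ (Fin n) → ℂ} (ha : a ∈ testSpace Ω)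
    (hb : b ∈ testSpace Ω) (k : Fin n) :
    Integrable (fun x => partialDeriv k a x * conj (partialDeriv k b x))
      (volume.restrict Ω) := by
  have hca : Continuous (partialDeriv k a) :=
    (ha.1.continuous_fderiv (by simp)).clm_apply continuous_const
  have hcb : Continuous (partialDeriv k b) :=
    (hb.1.continuous_fderiv (by simp)).clm_apply continuous_const
  refine (Continuous.integrable_of_hasCompactSupport
    (hca.mul (Complex.continuous_conj.comp hcb)) ?_).restrict
  exact (HasCompactSupport.fderiv_apply ℝ ha.2.1 (EuclideanSpace.single k 1)).mul_right

lemma integrable_mul (hV : IsRadonIn Ω V) {a b : EuclideanSpace ℝ (Fin n) → ℂ}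
    (ha : a ∈ testSpace Ω) (hb : b ∈ testSpace Ω) :
    Integrable (fun x => a x * conj (b x)) (V.restrict Ω) := by
  have hc : Continuous (fun x => a x * conj (b x)) :=
    ha.1.continuous.mul (Complex.continuous_conj.comp hb.1.continuous)
  have hs : HasCompactSupport (fun x => a x * conj (b x)) := ha.2.1.mul_right
  have hi : IntegrableOn (fun x => a x * conj (b x)) (tsupport a) V :=
    hc.continuousOn.integrableOn_of_subset_isCompact ha.2.1 (isClosed_tsupport a).measurableSet
      subset_rfl (hV _ ha.2.2 ha.2.1).ne
  have hj : Integrable (fun x => a x * conj (b x)) V := by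
    refine (integrableOn_iff_integrable_of_support_subset ?_).mp hi
    intro x hx
    refine subset_tsupport a ?_
    intro h0
    exact hx (by simp [h0])
  exact hj.restrict

lemma form_add_left (hV : IsRadonIn Ω V) {a b c : EuclideanSpace ℝ (Fin n) → ℂ}
    (ha : a ∈ testSpace Ω) (hb : b ∈ testSpace Ω) (hc : c ∈ testSpace Ω) :
    form Ω V (a + b) c = form Ω V a c + form Ω V b c := by
  simp only [form, partialDeriv_add ha hb, Pi.add_apply, add_mul]
  rw [integral_add (integrable_mul hV ha hc) (integrable_mul hV hb hc)]
  simp_rw [integral_add (integrable_partialDeriv_mul ha hc _)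
    (integrable_partialDeriv_mul hb hc _)]
  rw [Finset.sum_add_distrib]
  ring

lemma form_smul_left {a : EuclideanSpace ℝ (Fin n) → ℂ} (ha : a ∈ testSpace Ω) (z : ℂ)
    (c : EuclideanSpace ℝ (Fin n) → ℂ) :
    form Ω V (z • a) c = z * form Ω V a c := by
  simp only [form, partialDeriv_smul ha, Pi.smul_apply, smul_eq_mul, mul_assoc,
    integral_const_mul, mul_add, Finset.mul_sum]

lemma form_conj (a b : EuclideanSpace ℝ (Fin n) → ℂ) :
    conj (form Ω V a b) = form Ω V b a := by
  simp only [form, map_add, map_sum, ← integral_conj, map_mul, Complex.conj_conj, mul_comm]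

lemma form_self_nonneg (a : EuclideanSpace ℝ (Fin n) → ℂ) : 0 ≤ (form Ω V a a).re := by
  simp only [form, Complex.mul_conj, integral_complex_ofReal, Complex.add_re, Complex.re_sum,
    Complex.ofReal_re]
  exact add_nonneg (Finset.sum_nonneg fun k _ => integral_nonneg fun x => Complex.normSq_nonneg _)
    (integral_nonneg fun x => Complex.normSq_nonneg _)

lemma form_self_add_le (hV : IsRadonIn Ω V) {a b : EuclideanSpace ℝ (Fin n) → ℂ}
    (ha : a ∈ testSpace Ω) (hb : b ∈ testSpace Ω) :
    (form Ω V (a + b) (a + b)).re ≤ 2 * (form Ω V a a).re + 2 * (form Ω V b b).re := by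
  have key : ∀ z : ℂ, form Ω V (a + z • b) (a + z • b) =
      form Ω V a a + z * form Ω V b a + conj z * form Ω V a b + z * conj z * form Ω V b b := by
    intro z
    have hzb := (testSpace Ω).smul_mem z hb
    have hs := (testSpace Ω).add_mem ha hzb
    rw [form_add_left hV ha hzb hs, form_smul_left hb, ← form_conj (a + z • b) a,
      ← form_conj (a + z • b) b, form_add_left hV ha hzb ha, form_add_left hV ha hzb hb,
      form_smul_left hb, form_smul_left hb]
    simp only [map_add, map_mul, form_conj]
    ring
  have h1 := key 1
  have h2 := key (-1)
  have h3 := form_self_nonneg (Ω := Ω) (V := V) (a + (-1 : ℂ) • b)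
  simp only [one_smul, map_one, map_neg] at h1 h2
  rw [h2] at h3
  rw [h1]
  simp at h3 ⊢
  linarith

lemma FormApprox.add (hV : IsRadonIn Ω V) {φ ψ : ℕ → EuclideanSpace ℝ (Fin n) → ℂ} {u v : L2 Ω}
    (h : FormApprox Ω V φ u) (h' : FormApprox Ω V ψ v) :
    FormApprox Ω V (φ + ψ) (u + v) where
  mem j := (testSpace Ω).add_mem (h.mem j) (h'.mem j)
  cauchy := by
    have hl := (h.cauchy.const_mul 2).add (h'.cauchy.const_mul 2)
    simp only [mul_zero, add_zero] at hl
    refine squeeze_zero (fun p => form_self_nonneg _) (fun p => ?_) hl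
    have := form_self_add_le hV ((testSpace Ω).sub_mem (h.mem p.1) (h.mem p.2))
      ((testSpace Ω).sub_mem (h'.mem p.1) (h'.mem p.2))
    simpa only [Pi.add_apply, add_sub_add_comm] using this
  tendsto := by
    have hl := h.tendsto.add h'.tendsto
    simp only [add_zero] at hl
    refine tendsto_of_tendsto_of_tendsto_of_le_of_le tendsto_const_nhds hl
      (fun _ => zero_le) (fun j => ?_)
    have he : ((φ + ψ) j - ⇑(u + v) : EuclideanSpace ℝ (Fin n) → ℂ)
        =ᵐ[volume.restrict Ω] (φ j - ⇑u) + (ψ j - ⇑v) := by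
      filter_upwards [Lp.coeFn_add u v] with x hx
      simp only [Pi.add_apply, Pi.sub_apply, hx]
      ring
    rw [eLpNorm_congr_ae he]
    exact eLpNorm_add_le
      ((h.mem j).1.continuous.aestronglyMeasurable.sub (Lp.aestronglyMeasurable u))
      ((h'.mem j).1.continuous.aestronglyMeasurable.sub (Lp.aestronglyMeasurable v)) (by norm_num)

lemma FormApprox.smul {φ : ℕ → EuclideanSpace ℝ (Fin n) → ℂ} {u : L2 Ω}
    (h : FormApprox Ω V φ u) (c : ℂ) : FormApprox Ω V (c • φ) (c • u) where
  mem j := (testSpace Ω).smul_mem c (h.mem j)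
  cauchy := by
    have hl := h.cauchy.const_mul (Complex.normSq c)
    rw [mul_zero] at hl
    refine hl.congr fun p => ?_
    have hd := (testSpace Ω).sub_mem (h.mem p.1) (h.mem p.2)
    simp only [Pi.smul_apply, ← smul_sub]
    rw [form_smul_left hd, ← form_conj (c • (φ p.1 - φ p.2)) (φ p.1 - φ p.2), form_smul_left hd,
      map_mul, form_conj, ← mul_assoc, Complex.mul_conj, Complex.re_ofReal_mul]
  tendsto := by
    have hl := ENNReal.Tendsto.const_mul (a := ‖c‖ₑ) h.tendsto (Or.inr enorm_ne_top)
    rw [mul_zero] at hl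
    refine hl.congr fun j => ?_
    have he : ((c • φ) j - ⇑(c • u) : EuclideanSpace ℝ (Fin n) → ℂ)
        =ᵐ[volume.restrict Ω] c • (φ j - ⇑u) := by
      filter_upwards [Lp.coeFn_smul c u] with x hx
      simp only [Pi.smul_apply, Pi.sub_apply, hx, smul_sub]
    rw [eLpNorm_congr_ae he, eLpNorm_const_smul]

lemma FormApprox.zero : FormApprox Ω V 0 0 where
  mem j := (testSpace Ω).zero_mem
  cauchy := by simp [form, partialDeriv]
  tendsto := by
    refine tendsto_const_nhds.congr fun j => ?_
    have he : ((0 : ℕ → EuclideanSpace ℝ (Fin n) → ℂ) j - ⇑(0 : L2 Ω))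
        =ᵐ[volume.restrict Ω] 0 := by
      filter_upwards [Lp.coeFn_zero ℂ 2 (volume.restrict Ω)] with x hx
      simp only [Pi.sub_apply, hx, Pi.zero_apply, sub_zero]
    rw [eLpNorm_congr_ae he, eLpNorm_zero]

/-- The graph of the operator associated with the closure of `Q`: the pairs `(u, f)` such that `u`
lies in the domain of the closure and `Q[u, v] = (f, v)` for all `v` in that domain, the values of
the closure being the limits of those of `Q` along approximating sequences. -/
def schrodingerGraph (Ω : Set (EuclideanSpace ℝ (Fin n)))
    (V : Measure (EuclideanSpace ℝ (Fin n))) (hV : IsRadonIn Ω V) :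
    Submodule ℂ (L2 Ω × L2 Ω) where
  carrier := {p | ∃ φ, FormApprox Ω V φ p.1 ∧ ∀ (v : L2 Ω) (ψ : ℕ → EuclideanSpace ℝ (Fin n) → ℂ),
    FormApprox Ω V ψ v → Tendsto (fun j => form Ω V (φ j) (ψ j)) atTop (𝓝 (inner ℂ v p.2))}
  zero_mem' := ⟨0, FormApprox.zero, fun v ψ _ => by simp [form, partialDeriv]⟩
  add_mem' := by
    rintro p q ⟨φ, h, hq⟩ ⟨φ', h', hq'⟩
    refine ⟨φ + φ', h.add hV h', fun v ψ hψ => ?_⟩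
    rw [Prod.snd_add, inner_add_right]
    refine ((hq v ψ hψ).add (hq' v ψ hψ)).congr fun j => ?_
    exact (form_add_left hV (h.mem j) (h'.mem j) (hψ.mem j)).symm
  smul_mem' := by
    rintro c p ⟨φ, h, hq⟩
    refine ⟨c • φ, h.smul c, fun v ψ hψ => ?_⟩
    rw [Prod.smul_snd, inner_smul_right]
    exact ((hq v ψ hψ).const_mul c).congr fun j => (form_smul_left (h.mem j) c (ψ j)).symm

/-- The Schrödinger operator `H_V = -Δ + V` in `L₂(Ω)` with the Dirichlet condition: the operator
associated with the closure of the form `Q` from `C₀^∞(Ω)`. -/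
def schrodingerOperator (Ω : Set (EuclideanSpace ℝ (Fin n)))
    (V : Measure (EuclideanSpace ℝ (Fin n))) (hV : IsRadonIn Ω V) : L2 Ω →ₗ.[ℂ] L2 Ω :=
  (schrodingerGraph Ω V hV).toLinearPMap

end Form

end Schrodinger

end

/-!
# The essential spectrum of a Schrödinger operator with a measure potential

Multiplication by a plane wave `exp(i t x_k)` leaves the potential term of the form `Q` alone and
shifts the kinetic term:

`Q[e φ, ψ] = Q[φ, e⁻¹ ψ] - 2 i t (e ∂_k φ, ψ) + t² (e φ, ψ)`   (`Schrodinger.form_gaugeTest`).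

Hence, if `u` lies in the domain of `H = H_V`, then so does `e u`, and
`(H - t²)(e u) = e (H u - 2 i t ∂_k u)`, where `‖∂_k u‖² ≤ (H u, u)`
(`Schrodinger.exists_gaugeL2_eq`). If `s` lies in the essential spectrum, there is, for each
`ε > 0`, an infinite dimensional space of `u` with `‖(H - s) u‖ ≤ ε ‖u‖`. The products `w = e u` form
an infinite dimensional space too, and `‖(H - t²) w‖ ≤ (s + ε + 2 |t| √(s + ε)) ‖w‖` on it. This
forces the essential spectrum to have a point at about this distance from `t²`
(`Schrodinger.exists_mem_essentialSpectrum_near_sq`). The distance is `O(t)`, so these points tend to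
infinity with `t`. If `s = 0`, the distance tends to zero with `ε`, and `t²` itself belongs to the
essential spectrum, which is closed.

The operator is handled through the bounded operator `A = (H + 1)⁻¹ = J J*`, where `J` is the
natural map of the completion of `C₀^∞(Ω)` for the form norm into `L₂(Ω)`
(`Schrodinger.exists_approx_iff_eq_formResolvent`). The formula `A = J J*` holds whether or not `J` is
injective, and `A` is injective because the test functions are dense. The two facts about
approximate eigenvectors used above are Weyl's criterion with spaces of vectors in place of singular
sequences; they come from the continuous functional calculus of `A`
(`Schrodinger.IsShiftedInverse.exists_subspace` and
`Schrodinger.IsShiftedInverse.exists_mem_essentialSpectrum`).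
-/

noncomputable section

/-! ### Functional calculus of bounded self-adjoint operators -/

namespace BoundedSelfAdjoint

variable {H : Type*} [NormedAddCommGroup H] [InnerProductSpace ℂ H] [CompleteSpace H]
  {A : H →L[ℂ] H}

/-- Pointwise domination of two functions on the spectrum passes to the functional calculus. -/
lemma norm_cfc_apply_le {f h : ℝ → ℝ}
    (hf : ContinuousOn f (spectrum ℝ A)) (hh : ContinuousOn h (spectrum ℝ A))
    (hfh : ∀ x ∈ spectrum ℝ A, |f x| ≤ |h x|) (v : H) : ‖cfc f A v‖ ≤ ‖cfc h A v‖ := by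
  have h0 : 0 ≤ cfc (fun x => h x * h x - f x * f x) A := by
    refine cfc_nonneg fun x hx => ?_
    have := mul_self_le_mul_self (abs_nonneg _) (hfh x hx)
    rw [abs_mul_abs_self, abs_mul_abs_self] at this
    linarith
  rw [cfc_sub (fun x => h x * h x) (fun x => f x * f x) A (hh.mul hh) (hf.mul hf),
    cfc_mul h h A hh hh, cfc_mul f f A hf hf, ContinuousLinearMap.nonneg_iff_isPositive] at h0
  have key : ∀ k : ℝ → ℝ, inner ℂ ((cfc k A * cfc k A) v) v = (‖cfc k A v‖ : ℂ) ^ 2 := by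
    intro k
    have hk : IsSelfAdjoint (cfc k A) := cfc_predicate k A
    rw [mul_apply_eq_comp, ← ContinuousLinearMap.adjoint_inner_right,
      ← ContinuousLinearMap.star_eq_adjoint, hk.star_eq, inner_self_eq_norm_sq_to_K]
    rfl
  have h1 := h0.re_inner_nonneg_left v
  rw [sub_apply, inner_sub_left, key, key, map_sub] at h1
  norm_cast at h1
  exact (sq_le_sq₀ (norm_nonneg _) (norm_nonneg _)).mp (sub_nonneg.mp h1)

/-- The characteristic function of a finite set of isolated points is continuous on the
spectrum. -/
lemma continuousOn_indicator {s S : Set ℝ} (hS : S.Finite)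
    (hiso : ∀ x ∈ S, ∀ᶠ y in 𝓝 x, y ∈ s → y = x) :
    ContinuousOn (S.indicator (fun _ => (1 : ℝ))) s := by
  intro x hx
  refine tendsto_const_nhds.congr' ?_
  rw [EventuallyEq, eventually_nhdsWithin_iff]
  by_cases hxS : x ∈ S
  · filter_upwards [hiso x hxS] with y hy hys
    rw [hy hys]
  · filter_upwards [hS.isClosed.isOpen_compl.mem_nhds hxS] with y hy _
    rw [Set.indicator_of_notMem hxS, Set.indicator_of_notMem hy]

/-- The spectral projection of an isolated point maps into the kernel. -/
lemma cfc_indicator_singleton_apply (hA : IsSelfAdjoint A) {x : ℝ}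
    (hiso : ∀ᶠ y in 𝓝 x, y ∈ spectrum ℝ A → y = x) (v : H) :
    A (cfc (Set.indicator {x} (fun _ => (1 : ℝ))) A v) =
      x • cfc (Set.indicator {x} (fun _ => (1 : ℝ))) A v := by
  set f : ℝ → ℝ := Set.indicator {x} (fun _ => (1 : ℝ)) with hf
  have hc : ContinuousOn f (spectrum ℝ A) :=
    continuousOn_indicator (Set.finite_singleton x) (by rintro _ rfl; exact hiso)
  have h1 : A * cfc f A = x • cfc f A := by
    rw [← cfc_smul x f A hc]
    nth_rewrite 1 [← cfc_id' ℝ A]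
    rw [← cfc_mul (fun x => x) f A continuousOn_id hc]
    refine cfc_congr fun y _ => ?_
    by_cases hy : y = x
    · simp [hy]
    · simp [hf, hy]
  exact congrArg (fun B : H →L[ℂ] H => B v) h1

/-- If `f(A)` has finite rank, then `f` vanishes on the spectrum outside a finite set: for the
characteristic polynomial `p` of the restriction of `A` to the range, `p(A) f(A) = 0`, so `p f` is
zero on the spectrum. -/
lemma finite_of_finiteDimensional_range (hA : IsSelfAdjoint A) {f : ℝ → ℝ}
    (hf : ContinuousOn f (spectrum ℝ A))
    (hfin : FiniteDimensional ℂ (LinearMap.range (cfc f A).toLinearMap)) :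
    {x | x ∈ spectrum ℝ A ∧ f x ≠ 0}.Finite := by
  set L := LinearMap.range (cfc f A).toLinearMap
  have hinv : ∀ v ∈ L, A v ∈ L := by
    rintro _ ⟨w, rfl⟩
    refine ⟨A w, ?_⟩
    have := cfc_commute_cfc f (fun x => x) A
    rw [cfc_id' ℝ A] at this
    exact congrArg (fun B : H →L[ℂ] H => B w) this.eq
  have : Module.Finite ℝ L := Module.Finite.trans ℂ L
  set B : L →ₗ[ℝ] L := (A.toLinearMap.restrict hinv).restrictScalars ℝ
  have hpoly : ∀ (p : Polynomial ℝ) (v : L),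
      (Polynomial.aeval A p) (v : H) = ((Polynomial.aeval B p) v : L) := by
    intro p
    induction p using Polynomial.induction_on' with
    | add p q hp hq => intro v; simp [hp, hq]
    | monomial k a =>
      have hpow : ∀ v : L, (A ^ k) (v : H) = ((B ^ k) v : L) := by
        induction k with
        | zero => intro v; simp
        | succ k ih =>
          intro v
          rw [pow_succ, pow_succ, mul_apply_eq_comp, Module.End.mul_apply, ← ih]
          rfl
      intro v
      rw [Polynomial.aeval_monomial, Polynomial.aeval_monomial, Algebra.algebraMap_eq_smul_one,
        Algebra.algebraMap_eq_smul_one, smul_one_mul, smul_one_mul, smul_apply,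
        LinearMap.smul_apply, hpow]
      rfl
  set p := B.charpoly
  have hcont : ContinuousOn (fun x => p.eval x) (spectrum ℝ A) := p.continuous.continuousOn
  have hzero : cfc (fun x => p.eval x * f x) A = cfc (fun _ => (0 : ℝ)) A := by
    rw [cfc_mul (fun x => p.eval x) f A hcont hf, cfc_polynomial p A, cfc_const_zero]
    ext v
    rw [mul_apply_eq_comp]
    have := hpoly p ⟨cfc f A v, v, rfl⟩
    rw [LinearMap.aeval_self_charpoly] at this
    simpa using this
  have heq := (cfc_eq_cfc_iff_eqOn (ha := hA) (hcont.mul hf) continuousOn_const).mp hzero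
  refine (p.rootSet_finite ℝ).subset fun x hx => ?_
  rw [Polynomial.mem_rootSet]
  refine ⟨(LinearMap.charpoly_monic B).ne_zero, ?_⟩
  rw [Polynomial.coe_aeval_eq_eval]
  exact (mul_eq_zero.mp (heq hx.1)).resolve_right hx.2

end BoundedSelfAdjoint

namespace Schrodinger

/-! ### Operators given by their shifted inverse, and Weyl's criterion -/

section Resolvent

variable {H : Type*} [NormedAddCommGroup H] [InnerProductSpace ℂ H]
  {A : H →L[ℂ] H} {T : H →ₗ.[ℂ] H}

/-- `A = (T + 1)⁻¹`, expressed through the graph of `T`: its elements are the pairs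
`(A g, g - A g)`. -/
def IsShiftedInverse (A : H →L[ℂ] H) (T : H →ₗ.[ℂ] H) : Prop :=
  ∀ x y : H, (x, y) ∈ T.graph ↔ x = A (x + y)

lemma IsShiftedInverse.apply (h : IsShiftedInverse A T) (x : T.domain) :
    (x : H) = A (x + T x) :=
  (h _ _).mp (T.mem_graph x)

lemma IsShiftedInverse.exists_apply (h : IsShiftedInverse A T) (g : H) :
    ∃ x : T.domain, (x : H) = A g ∧ T x = g - A g := by
  have : (A g, g - A g) ∈ T.graph := (h _ _).mpr (by rw [add_sub_cancel])
  exact (LinearPMap.mem_graph_iff T).mp this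

lemma IsShiftedInverse.mem_resolventSet_iff (h : IsShiftedInverse A T) (z : ℂ) :
    z ∈ resolventSet T ↔ IsUnit (1 - (1 + z) • A) := by
  constructor
  · rintro ⟨R, hR, hR'⟩
    refine isUnit_iff_exists.mpr ⟨1 + (1 + z) • R, ?_, ?_⟩
    · ext y
      obtain ⟨x, hx, hxy⟩ := hR y
      have h1 := h.apply x
      have h2 : A (y + (1 + z) • R y) = R y := by
        rw [← hx]
        conv_rhs => rw [h1]
        congr 1
        rw [← hxy]
        module
      simp only [mul_apply_eq_comp, sub_apply, add_apply, smul_apply,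
        one_apply_eq_self, h2]
      module
    · ext v
      obtain ⟨x, hx, hxv⟩ := h.exists_apply v
      have h1 := hR' x
      have h2 : R (v - (1 + z) • A v) = A v := by
        have h3 : v - (1 + z) • A v = T x - z • (x : H) := by
          rw [hxv, hx]
          module
        rw [h3, h1, hx]
      simp only [mul_apply_eq_comp, sub_apply, add_apply, smul_apply,
        one_apply_eq_self, h2]
      module
  · intro hu
    obtain ⟨S, hNS, hSN⟩ := isUnit_iff_exists.mp hu
    refine ⟨A * S, fun y => ?_, fun x => ?_⟩
    · obtain ⟨x, hx, hxy⟩ := h.exists_apply (S y)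
      refine ⟨x, hx, ?_⟩
      have := congrArg (fun B : H →L[ℂ] H => B y) hNS
      simp only [mul_apply_eq_comp, sub_apply, smul_apply, one_apply_eq_self] at this
      rw [hxy, hx]
      refine Eq.trans ?_ this
      module
    · have h1 := h.apply x
      have := congrArg (fun B : H →L[ℂ] H => B (x + T x)) hSN
      simp only [mul_apply_eq_comp, sub_apply, smul_apply, one_apply_eq_self,
        ← h1] at this
      rw [mul_apply_eq_comp]
      conv_rhs => rw [h1, ← this]
      congr 2
      module

lemma IsShiftedInverse.mem_eigenspace_iff (h : IsShiftedInverse A T) (z : ℂ) (u : H) :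
    u ∈ eigenspace T z ↔ u = (1 + z) • A u := by
  have h1 : u ∈ eigenspace T z ↔ (u, z • u) ∈ T.graph := by
    rw [LinearPMap.mem_graph_iff]
    simp only [eigenspace, Submodule.mem_map, LinearMap.mem_ker, LinearMap.sub_apply,
      LinearMap.smul_apply, Submodule.subtype_apply, sub_eq_zero]
    constructor
    · rintro ⟨x, hx, rfl⟩
      exact ⟨x, rfl, hx⟩
    · rintro ⟨x, hx, hxz⟩
      refine ⟨x, ?_, hx⟩
      rw [hx]
      exact hxz
  rw [h1, h u (z • u), ← map_smul]
  congr! 2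
  module

variable [CompleteSpace H]

/-- The spectral mapping `t ↦ (1 + t)⁻¹` between the spectra of `T` and `A = (T + 1)⁻¹`. -/
lemma IsShiftedInverse.mem_spectrum_iff (h : IsShiftedInverse A T) (hA : IsSelfAdjoint A)
    (hσ : _root_.spectrum ℝ A ⊆ Set.Icc 0 1) (z : ℂ) :
    z ∈ spectrum T ↔ ∃ t : ℝ, 0 ≤ t ∧ z = t ∧ (1 + t)⁻¹ ∈ _root_.spectrum ℝ A := by
  have key : ∀ w : ℂ, w ≠ 0 → (¬ IsUnit (1 - w • A) ↔ w⁻¹ ∈ _root_.spectrum ℂ A) := by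
    intro w hw
    rw [_root_.spectrum.mem_iff, Algebra.algebraMap_eq_smul_one]
    have : w⁻¹ • (1 : H →L[ℂ] H) - A = (Units.mk0 w hw)⁻¹ • (1 - w • A) := by
      rw [Units.smul_def, Units.val_inv_eq_inv_val, Units.val_mk0, smul_sub, smul_smul,
        inv_mul_cancel₀ hw, one_smul]
    rw [this, isUnit_smul_iff]
  rw [spectrum, Set.mem_compl_iff, h.mem_resolventSet_iff]
  constructor
  · intro hz
    have hz1 : 1 + z ≠ 0 := by
      intro h0
      rw [h0] at hz
      simp at hz
    have hw := (key _ hz1).mp hz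
    have hre := hA.mem_spectrum_eq_re hw
    set r := ((1 + z)⁻¹).re with hr
    have hrm : r ∈ _root_.spectrum ℝ A := by
      rw [hre] at hw
      exact (_root_.spectrum.algebraMap_mem_iff ℂ).mp hw
    obtain ⟨h0, h1⟩ := hσ hrm
    have hr0 : r ≠ 0 := by
      intro h0
      rw [h0, Complex.ofReal_zero] at hre
      exact inv_ne_zero hz1 hre
    refine ⟨r⁻¹ - 1, sub_nonneg.mpr ((one_le_inv₀ (lt_of_le_of_ne h0 hr0.symm)).mpr h1), ?_, ?_⟩
    · push_cast
      rw [← hre, inv_inv]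
      ring
    · simpa using hrm
  · rintro ⟨t, ht, rfl, hm⟩
    have h1 : (1 + (t : ℂ)) ≠ 0 := by
      exact_mod_cast (by positivity : (1 + t) ≠ 0)
    rw [key _ h1]
    have := (_root_.spectrum.algebraMap_mem_iff ℂ).mpr hm
    simpa using this

lemma IsShiftedInverse.isClosed_spectrum (h : IsShiftedInverse A T) : IsClosed (spectrum T) := by
  have : resolventSet T = (fun z : ℂ => 1 - (1 + z) • A) ⁻¹' {B | IsUnit B} := by
    ext z
    exact h.mem_resolventSet_iff z
  rw [spectrum, this]
  refine (Units.isOpen.preimage ?_).isClosed_compl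
  fun_prop

/-- The essential spectrum is closed: a limit of its points belongs to the spectrum and is not
isolated there, unless the points are eventually equal to it. -/
lemma IsShiftedInverse.isClosed_essentialSpectrum (h : IsShiftedInverse A T) :
    IsClosed (essentialSpectrum T) := by
  rw [← closure_subset_iff_isClosed]
  intro z hz
  refine ⟨h.isClosed_spectrum.closure_subset_iff.mpr Set.sdiff_subset hz, ?_⟩
  rintro ⟨hzs, ⟨ε, hε, hiso⟩, hfin⟩
  obtain ⟨w, hw, hzw⟩ := Metric.mem_closure_iff.mp hz ε hε
  rw [dist_comm] at hzw
  have := hiso w hw.1 hzw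
  subst this
  exact hw.2 ⟨hzs, ⟨ε, hε, hiso⟩, hfin⟩

/-- Isolation of a point in the spectrum of `T`, in terms of `A = (T + 1)⁻¹`. -/
lemma IsShiftedInverse.isolated_iff (h : IsShiftedInverse A T) (hA : IsSelfAdjoint A)
    (hσ : _root_.spectrum ℝ A ⊆ Set.Icc 0 1) {t : ℝ} (ht : 0 ≤ t) :
    (∃ ε > 0, ∀ w ∈ spectrum T, dist w (t : ℂ) < ε → w = t) ↔
      ∀ᶠ y in 𝓝 (1 + t)⁻¹, y ∈ _root_.spectrum ℝ A → y = (1 + t)⁻¹ := by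
  have ht1 : (1 + t) ≠ 0 := by positivity
  constructor
  · rintro ⟨ε, hε, hiso⟩
    have hc : Tendsto (fun y : ℝ => y⁻¹ - 1) (𝓝 (1 + t)⁻¹) (𝓝 t) := by
      have := (tendsto_inv₀ (inv_ne_zero ht1)).sub_const 1
      simpa using this
    filter_upwards [hc (Metric.ball_mem_nhds t hε),
      lt_mem_nhds (inv_pos.mpr (by positivity : 0 < 1 + t))] with y hy hy0 hys
    have hm : ((y⁻¹ - 1 : ℝ) : ℂ) ∈ spectrum T := by
      rw [h.mem_spectrum_iff hA hσ]
      refine ⟨y⁻¹ - 1, sub_nonneg.mpr ((one_le_inv₀ hy0).mpr (hσ hys).2), rfl, ?_⟩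
      simpa using hys
    have := hiso _ hm (by
      rw [Complex.dist_eq, ← Complex.ofReal_sub, Complex.norm_real]
      exact hy)
    rw [← Complex.ofReal_inj.mp this]
    simp
  · intro hev
    have hc : Tendsto (fun y : ℝ => (1 + y)⁻¹) (𝓝 t) (𝓝 (1 + t)⁻¹) :=
      (tendsto_const_nhds.add tendsto_id).inv₀ ht1
    obtain ⟨ε, hε, hb⟩ := Metric.eventually_nhds_iff.mp (hc.eventually hev)
    refine ⟨ε, hε, fun w hw hd => ?_⟩
    obtain ⟨τ, hτ, rfl, hm⟩ := (h.mem_spectrum_iff hA hσ w).mp hw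
    rw [Complex.dist_eq, ← Complex.ofReal_sub, Complex.norm_real] at hd
    have := hb hd hm
    rw [inv_inj, add_right_inj] at this
    rw [this]

/-- A point of the essential spectrum admits approximate eigenvectors filling an infinite
dimensional space. -/
lemma IsShiftedInverse.exists_subspace (h : IsShiftedInverse A T) (hA : IsSelfAdjoint A)
    (hσ : _root_.spectrum ℝ A ⊆ Set.Icc 0 1) {t : ℝ} (ht : (t : ℂ) ∈ essentialSpectrum T)
    {ε : ℝ} (hε : 0 < ε) :
    ∃ W : Submodule ℂ H, ¬ FiniteDimensional ℂ W ∧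
      ∀ g ∈ W, ‖g - (1 + t) • A g‖ ≤ ε * ‖A g‖ := by
  obtain ⟨t', ht0, htt, hm⟩ := (h.mem_spectrum_iff hA hσ _).mp ht.1
  rw [← Complex.ofReal_inj.mp htt] at ht0 hm
  clear htt
  set x₀ := (1 + t)⁻¹ with hx₀
  have hx₀t : (1 + t) * x₀ = 1 := mul_inv_cancel₀ (by positivity)
  have hx₀p : 0 < x₀ := inv_pos.mpr (by positivity)
  -- positive exactly where `|1 - (1 + t) x| < ε x`, that is, near `x₀`
  set f : ℝ → ℝ := fun x => max 0 (ε * x - |1 - (1 + t) * x|) with hf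
  have hfc : Continuous f := by fun_prop
  by_cases hfin : FiniteDimensional ℂ (LinearMap.range (cfc f A).toLinearMap)
  -- if the range is finite dimensional, then `x₀` is isolated, hence an eigenvalue; as `t` is not in
  -- the discrete spectrum, the eigenspace is infinite dimensional
  · have hF := BoundedSelfAdjoint.finite_of_finiteDimensional_range hA hfc.continuousOn hfin
    have hiso : ∀ᶠ y in 𝓝 x₀, y ∈ _root_.spectrum ℝ A → y = x₀ := by
      have h1 : ∀ᶠ y in 𝓝 x₀, f y ≠ 0 := by
        refine hfc.continuousAt.eventually_ne ?_
        rw [hf]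
        simp only [hx₀t, sub_self, abs_zero, sub_zero]
        rw [max_eq_right (by positivity)]
        positivity
      have h2 : ∀ᶠ y in 𝓝 x₀, y ∉ {x | x ∈ _root_.spectrum ℝ A ∧ f x ≠ 0} \ {x₀} :=
        (hF.subset Set.sdiff_subset).isClosed.isOpen_compl.mem_nhds (by simp)
      filter_upwards [h1, h2] with y hy1 hy2 hys
      by_contra hne
      exact hy2 ⟨⟨hys, hy1⟩, hne⟩
    have hne : eigenspace T t ≠ ⊥ := by
      intro hbot
      have hz : cfc (Set.indicator {x₀} (fun _ => (1 : ℝ))) A = cfc (fun _ => (0 : ℝ)) A := by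
        rw [cfc_const_zero]
        ext v
        rw [zero_apply, ← Submodule.mem_bot ℂ, ← hbot, h.mem_eigenspace_iff,
          BoundedSelfAdjoint.cfc_indicator_singleton_apply hA hiso,
          ← Complex.coe_smul, smul_smul]
        norm_cast
        rw [hx₀t, one_smul]
      have := (cfc_eq_cfc_iff_eqOn (ha := hA) (BoundedSelfAdjoint.continuousOn_indicator
        (Set.finite_singleton x₀) (by rintro _ rfl; exact hiso)) continuousOn_const).mp hz hm
      simp at this
    refine ⟨eigenspace T t, fun hfd => ht.2 ⟨ht.1, (h.isolated_iff hA hσ ht0).mpr hiso, hne, hfd⟩,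
      fun g hg => ?_⟩
    have := (h.mem_eigenspace_iff _ _).mp hg
    rw [← Complex.coe_smul]
    push_cast
    rw [← this, sub_self, norm_zero]
    positivity
  · refine ⟨_, hfin, ?_⟩
    rintro _ ⟨v, rfl⟩
    have h1 := BoundedSelfAdjoint.norm_cfc_apply_le (A := A)
      (f := fun x => (1 - (1 + t) * x) * f x) (h := fun x => (ε * x) * f x)
      (by fun_prop) (by fun_prop) (fun x hx => ?_) v
    · rw [cfc_mul (fun x => 1 - (1 + t) * x) f A (by fun_prop) (by fun_prop),
        cfc_mul (fun x => ε * x) f A (by fun_prop) (by fun_prop),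
        cfc_sub (fun _ => 1) (fun x => (1 + t) * x) A (by fun_prop) (by fun_prop),
        cfc_const_one ℝ A, cfc_const_mul_id (1 + t) A, cfc_const_mul_id ε A] at h1
      simpa [norm_smul, abs_of_pos hε] using h1
    · rw [abs_mul, abs_mul]
      rcases le_or_gt (ε * x - |1 - (1 + t) * x|) 0 with h0 | h0
      · simp [hf, max_eq_left h0]
      · refine mul_le_mul_of_nonneg_right ?_ (abs_nonneg _)
        exact (sub_pos.mp h0).le.trans (le_abs_self _)

/-- Approximate eigenvectors filling an infinite dimensional space produce a point of the essential
spectrum nearby. -/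
lemma IsShiftedInverse.exists_mem_essentialSpectrum (h : IsShiftedInverse A T)
    (hA : IsSelfAdjoint A) (hσ : _root_.spectrum ℝ A ⊆ Set.Icc 0 1) {s r r' : ℝ}
    (hr : 0 ≤ r) (hrr : r < r') {W : Submodule ℂ H} (hW : ¬ FiniteDimensional ℂ W)
    (hest : ∀ g ∈ W, ‖g - (1 + s) • A g‖ ≤ r * ‖A g‖) :
    ∃ τ : ℝ, |τ - s| ≤ r' ∧ (τ : ℂ) ∈ essentialSpectrum T := by
  by_contra! hno
  -- the points of the spectrum of `A` that correspond to points of that of `T` within `r'` of `s`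
  set S : Set ℝ := {x | x ∈ _root_.spectrum ℝ A ∧ |1 - (1 + s) * x| ≤ r' * x} with hS
  have hdisc : ∀ x ∈ S, (∀ᶠ y in 𝓝 x, y ∈ _root_.spectrum ℝ A → y = x) ∧
      FiniteDimensional ℂ (LinearMap.ker (A.toLinearMap - (x : ℂ) • LinearMap.id)) := by
    intro x hx
    have hx0 : 0 < x := by
      refine lt_of_le_of_ne (hσ hx.1).1 ?_
      rintro rfl
      have := hx.2
      norm_num at this
    set τ := x⁻¹ - 1 with hτ
    have hτx : (1 + τ)⁻¹ = x := by simp [hτ]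
    have hτ0 : 0 ≤ τ := sub_nonneg.mpr ((one_le_inv₀ hx0).mpr (hσ hx.1).2)
    have hτs : |τ - s| ≤ r' := by
      have : 1 - (1 + s) * x = (τ - s) * x := by
        rw [hτ]
        field_simp
        ring
      have h2 := hx.2
      rw [this, abs_mul, abs_of_pos hx0] at h2
      exact le_of_mul_le_mul_right h2 hx0
    have hm : (τ : ℂ) ∈ spectrum T := (h.mem_spectrum_iff hA hσ _).mpr ⟨τ, hτ0, rfl, hτx ▸ hx.1⟩
    have hd : (τ : ℂ) ∈ discreteSpectrum T := by
      by_contra hd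
      exact hno τ hτs ⟨hm, hd⟩
    refine ⟨by simpa only [hτx] using (h.isolated_iff hA hσ hτ0).mp hd.2.1, ?_⟩
    have he : LinearMap.ker (A.toLinearMap - (x : ℂ) • LinearMap.id) = eigenspace T τ := by
      ext u
      have hne : (x : ℂ) ≠ 0 := by exact_mod_cast hx0.ne'
      rw [h.mem_eigenspace_iff, LinearMap.mem_ker, LinearMap.sub_apply, sub_eq_zero,
        LinearMap.smul_apply, LinearMap.id_apply]
      have : (1 + (τ : ℂ)) = (x : ℂ)⁻¹ := by
        rw [hτ]
        push_cast
        ring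
      rw [this, eq_inv_smul_iff₀ hne]
      exact eq_comm
    rw [he]
    exact hd.2.2.2
  have hSfin : S.Finite := by
    have hcomp : IsCompact S := by
      refine (_root_.spectrum.isCompact A).inter_right (t := {x | |1 - (1 + s) * x| ≤ r' * x}) ?_
      exact isClosed_le (by fun_prop) (by fun_prop)
    refine hcomp.finite (IsDiscrete.of_nhdsWithin fun x hx => ?_)
    rw [Filter.le_pure_iff, mem_nhdsWithin_iff_eventually]
    exact (hdisc x hx).1.mono fun y hy hyS => hy hyS.1
  set P := cfc (S.indicator (fun _ => (1 : ℝ))) A with hP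
  have hc : ContinuousOn (S.indicator (fun _ => (1 : ℝ))) (_root_.spectrum ℝ A) :=
    BoundedSelfAdjoint.continuousOn_indicator hSfin fun x hx => (hdisc x hx).1
  have hPfin : FiniteDimensional ℂ (LinearMap.range P.toLinearMap) := by
    have hsingle : ∀ x ∈ hSfin.toFinset, ContinuousOn (Set.indicator {x} (fun _ => (1 : ℝ)))
        (_root_.spectrum ℝ A) := fun x hx =>
      BoundedSelfAdjoint.continuousOn_indicator (Set.finite_singleton x)
        (by rintro _ rfl; exact (hdisc _ (hSfin.mem_toFinset.mp hx)).1)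
    have hsum : P = ∑ x ∈ hSfin.toFinset, cfc (Set.indicator {x} (fun _ => (1 : ℝ))) A := by
      rw [hP, ← cfc_sum (fun x => Set.indicator {x} (fun _ => (1 : ℝ))) A hSfin.toFinset hsingle]
      refine cfc_congr fun y _ => ?_
      rw [Finset.sum_apply]
      by_cases hy : y ∈ S <;> simp [Set.indicator_apply, Finset.sum_ite_eq, hy]
    have hfinite : Finite S := hSfin.to_subtype
    have hfd : ∀ x : S, FiniteDimensional ℂ
        (LinearMap.ker (A.toLinearMap - ((x : ℝ) : ℂ) • LinearMap.id)) := fun x => (hdisc x x.2).2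
    have hle : LinearMap.range P.toLinearMap ≤
        ⨆ x : S, LinearMap.ker (A.toLinearMap - ((x : ℝ) : ℂ) • LinearMap.id) := by
      rintro _ ⟨v, rfl⟩
      rw [ContinuousLinearMap.coe_coe, hsum, sum_apply]
      refine Submodule.sum_mem _ fun x hx => ?_
      have hxS := hSfin.mem_toFinset.mp hx
      refine Submodule.mem_iSup_of_mem (⟨x, hxS⟩ : S) ?_
      rw [LinearMap.mem_ker, LinearMap.sub_apply, sub_eq_zero]
      exact BoundedSelfAdjoint.cfc_indicator_singleton_apply hA (hdisc x hxS).1 v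
    exact Submodule.finiteDimensional_of_le hle
  -- the projection has finite rank, so it is not injective on the infinite dimensional space `W`
  obtain ⟨g, hgW, hPg, hg0⟩ : ∃ g ∈ W, P g = 0 ∧ g ≠ 0 := by
    by_contra! hcon
    apply hW
    refine FiniteDimensional.of_injective
      ((P.toLinearMap.rangeRestrict).comp W.subtype) ?_
    rw [← LinearMap.ker_eq_bot, LinearMap.ker_eq_bot']
    rintro ⟨g, hg⟩ hPg
    exact Subtype.ext (hcon g hg (congrArg Subtype.val hPg))
  -- off `S`, the norm of `(T - s) u` exceeds `r' ‖u‖`, against the assumption on `W`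
  have h1 := BoundedSelfAdjoint.norm_cfc_apply_le (A := A)
      (f := fun x => (r' * x) * (1 - S.indicator (fun _ => (1 : ℝ)) x))
      (h := fun x => (1 - (1 + s) * x) * (1 - S.indicator (fun _ => (1 : ℝ)) x))
      (by fun_prop) (by fun_prop) (fun x hx => ?_) g
  · have hQ : ContinuousOn (fun x => 1 - S.indicator (fun _ => (1 : ℝ)) x)
      (_root_.spectrum ℝ A) := by fun_prop
    rw [cfc_mul (fun x => 1 - (1 + s) * x) _ A (by fun_prop) hQ,
      cfc_mul (fun x => r' * x) _ A (by fun_prop) hQ,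
      cfc_sub (fun _ => 1) (fun x => (1 + s) * x) A (by fun_prop) (by fun_prop),
      cfc_sub (fun _ => 1) _ A (by fun_prop) hc,
      cfc_const_one ℝ A, cfc_const_mul_id (1 + s) A, cfc_const_mul_id r' A] at h1
    simp only [mul_apply_eq_comp, sub_apply, ← hP, hPg, smul_apply,
      one_apply_eq_self, sub_zero, norm_smul, Real.norm_eq_abs,
      abs_of_pos (hr.trans_lt hrr)] at h1
    have h2 := hest g hgW
    have h3 : ‖A g‖ = 0 := by nlinarith [norm_nonneg (A g)]
    rw [norm_eq_zero.mp h3, smul_zero, sub_zero, norm_zero, mul_zero] at h2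
    exact hg0 (norm_le_zero_iff.mp h2)
  · by_cases hxS : x ∈ S
    · simp [hxS]
    · have h0 := (hσ hx).1
      have : r' * x < |1 - (1 + s) * x| := by
        by_contra! hle
        exact hxS ⟨hx, hle⟩
      rw [Set.indicator_of_notMem hxS, sub_zero, mul_one, mul_one,
        abs_of_nonneg (mul_nonneg (hr.trans hrr.le) h0)]
      exact this.le

end Resolvent

/-! ### The operator associated with a form, and gauge transformations -/

section AbstractForm

variable {X H G : Type*} [AddCommGroup X] [Module ℂ X]
  [NormedAddCommGroup H] [InnerProductSpace ℂ H] [NormedAddCommGroup G] [InnerProductSpace ℂ G]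

/-- The graph of `b` over `a`, for linear maps `a : X → H` and `b : X → G`. Its norm is the form
norm of the quadratic form `‖b φ‖²`. -/
def energyMap (a : X →ₗ[ℂ] H) (b : X →ₗ[ℂ] G) : X →ₗ[ℂ] WithLp 2 (H × G) :=
  (WithLp.linearEquiv 2 ℂ (H × G)).symm.toLinearMap ∘ₗ a.prod b

/-- The completion of `X` for the form norm, realised as a closed subspace. -/
def energySpace (a : X →ₗ[ℂ] H) (b : X →ₗ[ℂ] G) : Submodule ℂ (WithLp 2 (H × G)) :=
  (LinearMap.range (energyMap a b)).topologicalClosure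

/-- The natural map from the form completion to `H`. It is not assumed injective, that is, the form
is not assumed closable. -/
def energyEmbed (a : X →ₗ[ℂ] H) (b : X →ₗ[ℂ] G) : energySpace a b →L[ℂ] H :=
  (WithLp.fstL 2 ℂ H G).comp (energySpace a b).subtypeL

variable {a : X →ₗ[ℂ] H} {b : X →ₗ[ℂ] G}

lemma inner_energyMap (ψ : X) (p : WithLp 2 (H × G)) :
    inner ℂ (energyMap a b ψ) p = inner ℂ (a ψ) p.fst + inner ℂ (b ψ) p.snd :=
  WithLp.prod_inner_apply _ _

lemma tendsto_energyMap_iff {φ : ℕ → X} {p : WithLp 2 (H × G)} :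
    Tendsto (fun j => energyMap a b (φ j)) atTop (𝓝 p) ↔
      Tendsto (fun j => a (φ j)) atTop (𝓝 p.fst) ∧ Tendsto (fun j => b (φ j)) atTop (𝓝 p.snd) := by
  constructor
  · intro h
    exact ⟨((WithLp.fstL 2 ℂ H G).continuous.tendsto p).comp h,
      ((WithLp.sndL 2 ℂ H G).continuous.tendsto p).comp h⟩
  · rintro ⟨h1, h2⟩
    exact ((WithLp.prodContinuousLinearEquiv 2 ℂ H G).symm.continuous.tendsto (p.fst, p.snd)).comp
      (h1.prodMk_nhds h2)

lemma mem_energySpace_of_tendsto {φ : ℕ → X} {p : WithLp 2 (H × G)}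
    (h : Tendsto (fun j => energyMap a b (φ j)) atTop (𝓝 p)) : p ∈ energySpace a b :=
  mem_closure_of_tendsto h (Eventually.of_forall fun j => ⟨φ j, rfl⟩)

lemma exists_tendsto_of_mem_energySpace {p : WithLp 2 (H × G)} (hp : p ∈ energySpace a b) :
    ∃ φ : ℕ → X, Tendsto (fun j => energyMap a b (φ j)) atTop (𝓝 p) := by
  obtain ⟨x, hx, hxp⟩ := mem_closure_iff_seq_limit.mp hp
  choose φ hφ using hx
  exact ⟨φ, by simpa only [hφ] using hxp⟩

variable [CompleteSpace H] [CompleteSpace G]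

instance : CompleteSpace (energySpace a b) :=
  (Submodule.isClosed_topologicalClosure _).completeSpace_coe

/-- The operator `J J*`, for the natural map `J` from the form completion to `H`. It is the inverse
of `T + 1`, for the operator `T` associated with the form. -/
def formResolvent (a : X →ₗ[ℂ] H) (b : X →ₗ[ℂ] G) : H →L[ℂ] H :=
  (energyEmbed a b).comp (energyEmbed a b).adjoint

lemma isPositive_formResolvent : (formResolvent a b).IsPositive :=
  ContinuousLinearMap.isPositive_self_comp_adjoint _

lemma spectrum_formResolvent_subset : _root_.spectrum ℝ (formResolvent a b) ⊆ Set.Icc 0 1 := by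
  have hJ : ‖energyEmbed a b‖ ≤ 1 := by
    refine ContinuousLinearMap.opNorm_le_bound _ zero_le_one fun p => ?_
    rw [one_mul]
    exact WithLp.norm_fst_le _ (p : WithLp 2 (H × G))
  have hn : ‖formResolvent a b‖ ≤ 1 := by
    refine (ContinuousLinearMap.opNorm_comp_le _ _).trans ?_
    rw [LinearIsometryEquiv.norm_map]
    exact mul_le_one₀ hJ (norm_nonneg (energyEmbed a b)) hJ
  intro x hx
  refine ⟨spectrum_nonneg_of_nonneg
    ((ContinuousLinearMap.nonneg_iff_isPositive _).mpr isPositive_formResolvent) hx, ?_⟩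
  have h1 := _root_.spectrum.subset_closedBall_norm_mul _ hx
  rw [mem_closedBall_zero_iff] at h1
  refine (le_abs_self x).trans (h1.trans ?_)
  exact mul_le_one₀ hn (norm_nonneg _) ContinuousLinearMap.norm_id_le

/-- The adjoint of the natural map is characterised by its pairing with the elements of `X`. -/
lemma adjoint_energyEmbed_eq_iff {p : WithLp 2 (H × G)} (hp : p ∈ energySpace a b) (g : H) :
    ((energyEmbed a b).adjoint g : WithLp 2 (H × G)) = p ↔
      ∀ ψ : X, inner ℂ (energyMap a b ψ) p = inner ℂ (a ψ) g := by
  have hψ : ∀ ψ : X, inner ℂ (energyMap a b ψ)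
      ((energyEmbed a b).adjoint g : WithLp 2 (H × G)) = inner ℂ (a ψ) g := by
    intro ψ
    have hm : energyMap a b ψ ∈ energySpace a b :=
      Submodule.le_topologicalClosure _ ⟨ψ, rfl⟩
    exact ContinuousLinearMap.adjoint_inner_right (energyEmbed a b) ⟨_, hm⟩ g
  constructor
  · rintro rfl ψ
    exact hψ ψ
  · intro h
    rw [← sub_eq_zero]
    set q := ((energyEmbed a b).adjoint g : WithLp 2 (H × G)) - p with hq
    have hqm : q ∈ energySpace a b := Submodule.sub_mem _ (Submodule.coe_mem _) hp
    obtain ⟨χ, hχ⟩ := exists_tendsto_of_mem_energySpace hqm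
    have h0 : Tendsto (fun j => inner ℂ (energyMap a b (χ j)) q) atTop (𝓝 (inner ℂ q q)) :=
      hχ.inner tendsto_const_nhds
    have h1 : ∀ j, inner ℂ (energyMap a b (χ j)) q = 0 := by
      intro j
      rw [hq, inner_sub_right, hψ, h, sub_self]
    simp only [h1] at h0
    exact inner_self_eq_zero.mp (tendsto_nhds_unique h0 tendsto_const_nhds)

lemma eq_zero_of_formResolvent_eq_zero (hdense : ∀ g : H, (∀ ψ, inner ℂ (a ψ) g = 0) → g = 0)
    {g : H} (h : formResolvent a b g = 0) : g = 0 := by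
  have h0 : (energyEmbed a b).adjoint g = 0 := by
    have := congrArg (inner ℂ g) h
    rw [formResolvent, ContinuousLinearMap.comp_apply, ← ContinuousLinearMap.adjoint_inner_left,
      inner_zero_right] at this
    exact inner_self_eq_zero.mp this
  refine hdense g fun ψ => ?_
  rw [← (adjoint_energyEmbed_eq_iff (a := a) (b := b) (Submodule.zero_mem _) g).mp (by rw [h0]; rfl)]
  exact inner_zero_right _

/-- The graph of the operator associated with the form, described by sequences, is the set of the
pairs `(u, f)` with `u = J J* (u + f)`. -/
lemma exists_approx_iff_eq_formResolvent (u f : H) :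
    (∃ φ : ℕ → X, (CauchySeq (fun j => b (φ j)) ∧ Tendsto (fun j => a (φ j)) atTop (𝓝 u)) ∧
      ∀ (v : H) (ψ : ℕ → X),
        (CauchySeq (fun j => b (ψ j)) ∧ Tendsto (fun j => a (ψ j)) atTop (𝓝 v)) →
          Tendsto (fun j => inner ℂ (b (ψ j)) (b (φ j))) atTop (𝓝 (inner ℂ v f))) ↔
      u = formResolvent a b (u + f) := by
  constructor
  · rintro ⟨φ, ⟨hφ, hu⟩, hlim⟩
    obtain ⟨w, hw⟩ := cauchySeq_tendsto_of_complete hφ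
    have hp : Tendsto (fun j => energyMap a b (φ j)) atTop (𝓝 (WithLp.toLp 2 (u, w))) :=
      tendsto_energyMap_iff.mpr ⟨hu, hw⟩
    have hadj := (adjoint_energyEmbed_eq_iff (mem_energySpace_of_tendsto hp) (u + f)).mpr ?_
    · have := congrArg WithLp.fst hadj
      exact this.symm
    · intro ψ
      have h1 := hlim (a ψ) (fun _ => ψ) ⟨cauchySeq_const _, tendsto_const_nhds⟩
      have h2 : Tendsto (fun j => inner ℂ (b ψ) (b (φ j))) atTop (𝓝 (inner ℂ (b ψ) w)) :=
        tendsto_const_nhds.inner hw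
      rw [inner_energyMap, inner_add_right]
      exact congrArg _ (tendsto_nhds_unique h2 h1)
  · intro h
    set p : WithLp 2 (H × G) := ((energyEmbed a b).adjoint (u + f)).1 with hp
    have hpm : p ∈ energySpace a b := Submodule.coe_mem _
    have hpu : p.fst = u := h.symm
    obtain ⟨φ, hφ⟩ := exists_tendsto_of_mem_energySpace hpm
    have hφ' := tendsto_energyMap_iff.mp hφ
    rw [hpu] at hφ'
    refine ⟨φ, ⟨hφ'.2.cauchySeq, hφ'.1⟩, ?_⟩
    rintro v ψ ⟨hψ, hv⟩
    obtain ⟨w, hw⟩ := cauchySeq_tendsto_of_complete hψ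
    have h1 : inner ℂ w p.snd = inner ℂ v f := by
      have h2 : ∀ j, inner ℂ (b (ψ j)) p.snd = inner ℂ (a (ψ j)) f := by
        intro j
        have := (adjoint_energyEmbed_eq_iff hpm (u + f)).mp rfl (ψ j)
        rw [inner_energyMap, hpu, inner_add_right] at this
        exact add_left_cancel this
      have h3 : Tendsto (fun j => inner ℂ (b (ψ j)) p.snd) atTop (𝓝 (inner ℂ w p.snd)) :=
        hw.inner tendsto_const_nhds
      simp only [h2] at h3
      exact tendsto_nhds_unique h3 (hv.inner tendsto_const_nhds)
    rw [← h1]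
    exact hw.inner hφ'.2

/-- A gauge transformation `M` of the form, such as multiplication by `exp(i t x_k)` for the
Dirichlet form, preserves the domain of the associated operator. What it adds to the operator is a
multiple of the first order term `M δ b u`, bounded in terms of the form norm, and the constant
`t²`. -/
lemma exists_gauge_apply {M : H →L[ℂ] H} (hM : ∀ x, ‖M x‖ = ‖x‖) {δ : G →L[ℂ] H}
    (hδ : ∀ x, ‖δ x‖ ≤ ‖x‖) {m : X →ₗ[ℂ] X} {m' : X → X} (hm : ∀ φ, m' (m φ) = φ)
    (ham : ∀ φ, a (m φ) = M (a φ)) (ham' : ∀ ψ f, inner ℂ (a (m' ψ)) f = inner ℂ (a ψ) (M f))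
    {t : ℝ} (hform : ∀ φ ψ, inner ℂ (b ψ) (b (m φ)) = inner ℂ (b (m' ψ)) (b φ)
      - 2 * Complex.I * t * inner ℂ (a ψ) (M (δ (b φ))) + t ^ 2 * inner ℂ (a ψ) (M (a φ)))
    {u f : H} (h : u = formResolvent a b (u + f)) :
    ∃ f', M u = formResolvent a b (M u + f') ∧
      ‖f' - (t ^ 2) • M u‖ ≤ ‖f‖ + 2 * |t| * √(‖u‖ * ‖f‖) := by
  set p : WithLp 2 (H × G) := ((energyEmbed a b).adjoint (u + f)).1 with hp
  have hpm : p ∈ energySpace a b := Submodule.coe_mem _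
  have hpu : p.fst = u := h.symm
  obtain ⟨φ, hφ⟩ := exists_tendsto_of_mem_energySpace hpm
  have hφ' := tendsto_energyMap_iff.mp hφ
  rw [hpu] at hφ'
  have hpψ : ∀ ψ, inner ℂ (b ψ) p.snd = inner ℂ (a ψ) f := by
    intro ψ
    have := (adjoint_energyEmbed_eq_iff hpm (u + f)).mp rfl ψ
    rw [inner_energyMap, hpu, inner_add_right] at this
    exact add_left_cancel this
  have hpf : ‖p.snd‖ ^ 2 ≤ ‖u‖ * ‖f‖ := by
    have h1 : Tendsto (fun j => inner ℂ (b (φ j)) p.snd) atTop (𝓝 (inner ℂ p.snd p.snd)) :=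
      hφ'.2.inner tendsto_const_nhds
    simp only [hpψ] at h1
    have h2 : inner ℂ p.snd p.snd = inner ℂ u f :=
      tendsto_nhds_unique h1 (hφ'.1.inner tendsto_const_nhds)
    rw [inner_self_eq_norm_sq_to_K] at h2
    have h3 := norm_inner_le_norm (𝕜 := ℂ) u f
    rw [← h2] at h3
    simpa using h3
  -- the transformation is bounded for the form norm, as `hform` with `ψ = m χ` shows
  have hbm : ∀ χ, ‖b (m χ)‖ ≤ ‖b χ‖ + |t| * ‖a χ‖ := by
    intro χ
    have h1 := hform χ (m χ)
    rw [hm, ham, inner_self_eq_norm_sq_to_K, inner_self_eq_norm_sq_to_K,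
      inner_self_eq_norm_sq_to_K, hM] at h1
    have h3 : ‖(2 * Complex.I * t * inner ℂ (M (a χ)) (M (δ (b χ))) : ℂ)‖ ≤
        2 * |t| * (‖a χ‖ * ‖b χ‖) := by
      rw [norm_mul]
      have h4 : ‖inner ℂ (M (a χ)) (M (δ (b χ)))‖ ≤ ‖a χ‖ * ‖b χ‖ := by
        refine (norm_inner_le_norm _ _).trans ?_
        rw [hM, hM]
        exact mul_le_mul_of_nonneg_left (hδ _) (norm_nonneg _)
      have h5 : ‖(2 * Complex.I * t : ℂ)‖ = 2 * |t| := by simp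
      rw [h5]
      exact mul_le_mul_of_nonneg_left h4 (by positivity)
    generalize (2 * Complex.I * t * inner ℂ (M (a χ)) (M (δ (b χ))) : ℂ) = z at h1 h3
    have h6 : ‖b (m χ)‖ ^ 2 ≤ (‖b χ‖ + |t| * ‖a χ‖) ^ 2 := by
      calc ‖b (m χ)‖ ^ 2 = ‖((‖b χ‖ : ℂ) ^ 2 - z + (t : ℂ) ^ 2 * (‖a χ‖ : ℂ) ^ 2)‖ := by
            refine Eq.trans ?_ (congrArg norm h1)
            simp
        _ ≤ ‖((‖b χ‖ : ℂ) ^ 2)‖ + ‖z‖ + ‖((t : ℂ) ^ 2 * (‖a χ‖ : ℂ) ^ 2)‖ :=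
            (norm_add_le _ _).trans (add_le_add (norm_sub_le _ _) le_rfl)
        _ ≤ ‖b χ‖ ^ 2 + 2 * |t| * (‖a χ‖ * ‖b χ‖) + |t| ^ 2 * ‖a χ‖ ^ 2 := by
            refine add_le_add (add_le_add ?_ h3) ?_ <;> simp
        _ = (‖b χ‖ + |t| * ‖a χ‖) ^ 2 := by ring
    exact (sq_le_sq₀ (norm_nonneg _) (by positivity)).mp h6
  have hcauchy : CauchySeq (fun j => b (m (φ j))) := by
    rw [cauchySeq_iff_tendsto_dist_atTop_0]
    have h1 := cauchySeq_iff_tendsto_dist_atTop_0.mp hφ'.2.cauchySeq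
    have h2 := cauchySeq_iff_tendsto_dist_atTop_0.mp hφ'.1.cauchySeq
    have h3 := h1.add (h2.const_mul |t|)
    rw [mul_zero, add_zero] at h3
    refine squeeze_zero (fun _ => dist_nonneg) (fun n => ?_) h3
    simp only [dist_eq_norm, ← map_sub]
    exact hbm _
  obtain ⟨w, hw⟩ := cauchySeq_tendsto_of_complete hcauchy
  have hMu : Tendsto (fun j => a (m (φ j))) atTop (𝓝 (M u)) := by
    simp only [ham]
    exact (M.continuous.tendsto u).comp hφ'.1
  have hq : Tendsto (fun j => energyMap a b (m (φ j))) atTop (𝓝 (WithLp.toLp 2 (M u, w))) :=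
    tendsto_energyMap_iff.mpr ⟨hMu, hw⟩
  refine ⟨M f - (2 * Complex.I * t) • M (δ p.snd) + ((t : ℂ) ^ 2) • M u, ?_, ?_⟩
  · have hadj := (adjoint_energyEmbed_eq_iff (mem_energySpace_of_tendsto hq)
      (M u + (M f - (2 * Complex.I * t) • M (δ p.snd) + ((t : ℂ) ^ 2) • M u))).mpr ?_
    · have := congrArg WithLp.fst hadj
      exact this.symm
    · intro ψ
      have h1 : Tendsto (fun j => inner ℂ (b ψ) (b (m (φ j)))) atTop (𝓝 (inner ℂ (b ψ) w)) :=
        tendsto_const_nhds.inner hw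
      simp only [hform] at h1
      have hδM : Tendsto (fun j => M (δ (b (φ j)))) atTop (𝓝 (M (δ p.snd))) :=
        ((M.continuous.comp δ.continuous).tendsto _).comp hφ'.2
      have hMa : Tendsto (fun j => M (a (φ j))) atTop (𝓝 (M u)) :=
        (M.continuous.tendsto _).comp hφ'.1
      have h2 : Tendsto (fun j => inner ℂ (b (m' ψ)) (b (φ j))
          - 2 * Complex.I * t * inner ℂ (a ψ) (M (δ (b (φ j))))
          + (t : ℂ) ^ 2 * inner ℂ (a ψ) (M (a (φ j)))) atTop
          (𝓝 (inner ℂ (b (m' ψ)) p.snd - 2 * Complex.I * t * inner ℂ (a ψ) (M (δ p.snd))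
            + (t : ℂ) ^ 2 * inner ℂ (a ψ) (M u))) :=
        ((tendsto_const_nhds.inner hφ'.2).sub
          ((tendsto_const_nhds.inner hδM).const_mul _)).add
          ((tendsto_const_nhds.inner hMa).const_mul _)
      have h3 := tendsto_nhds_unique h1 h2
      rw [inner_energyMap]
      change inner ℂ (a ψ) (M u) + inner ℂ (b ψ) w = _
      rw [h3, hpψ, ham']
      simp only [inner_add_right, inner_sub_right, inner_smul_right]
  · have h1 : M f - (2 * Complex.I * t) • M (δ p.snd) + ((t : ℂ) ^ 2) • M u - (t ^ 2) • M u =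
        M f - (2 * Complex.I * t) • M (δ p.snd) := by
      rw [← Complex.coe_smul]
      push_cast
      abel
    rw [h1]
    refine (norm_sub_le _ _).trans ?_
    rw [hM, norm_smul, hM]
    have h2 : ‖(2 * Complex.I * t : ℂ)‖ = 2 * |t| := by simp
    rw [h2]
    gcongr
    exact (hδ _).trans (Real.le_sqrt_of_sq_le hpf)

end AbstractForm

/-! ### The form of the Schrödinger operator -/

section DirichletForm

/-- A linear map into square integrable functions, as a linear map into `L₂`. -/
def lpLinearMap {X α : Type*} [AddCommGroup X] [Module ℂ X] [MeasurableSpace α] {μ : Measure α}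
    (P : X →ₗ[ℂ] (α → ℂ)) (hP : ∀ φ, MemLp (P φ) 2 μ) : X →ₗ[ℂ] Lp ℂ 2 μ where
  toFun φ := (hP φ).toLp (P φ)
  map_add' φ ψ := by
    rw [← MemLp.toLp_add]
    exact MemLp.toLp_congr _ _ (by rw [map_add])
  map_smul' c φ := by
    rw [RingHom.id_apply, ← MemLp.toLp_const_smul]
    exact MemLp.toLp_congr _ _ (by rw [map_smul])

lemma inner_lpLinearMap_left {X α : Type*} [AddCommGroup X] [Module ℂ X] [MeasurableSpace α]
    {μ : Measure α} {P : X →ₗ[ℂ] (α → ℂ)} (hP : ∀ φ, MemLp (P φ) 2 μ) (ψ : X) (g : Lp ℂ 2 μ) :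
    inner ℂ (lpLinearMap P hP ψ) g = ∫ x, g x * conj (P ψ x) ∂μ := by
  rw [L2.inner_def]
  refine integral_congr_ae ?_
  filter_upwards [(hP ψ).coeFn_toLp] with x hx
  rw [RCLike.inner_apply]
  exact congrArg (fun z : ℂ => g x * conj z) hx

lemma inner_lpLinearMap {X α : Type*} [AddCommGroup X] [Module ℂ X] [MeasurableSpace α]
    {μ : Measure α} {P Q : X →ₗ[ℂ] (α → ℂ)} (hP : ∀ φ, MemLp (P φ) 2 μ)
    (hQ : ∀ φ, MemLp (Q φ) 2 μ) (ψ φ : X) :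
    inner ℂ (lpLinearMap P hP ψ) (lpLinearMap Q hQ φ) = ∫ x, Q φ x * conj (P ψ x) ∂μ := by
  rw [inner_lpLinearMap_left]
  refine integral_congr_ae ?_
  filter_upwards [(hQ φ).coeFn_toLp] with x hx
  exact congrArg (fun z : ℂ => z * conj (P ψ x)) hx

variable {n : ℕ} {Ω : Set (EuclideanSpace ℝ (Fin n))} {V : Measure (EuclideanSpace ℝ (Fin n))}

lemma continuous_partialDeriv {φ : EuclideanSpace ℝ (Fin n) → ℂ} (hφ : φ ∈ testSpace Ω)
    (k : Fin n) : Continuous (partialDeriv k φ) :=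
  (hφ.1.continuous_fderiv (by simp)).clm_apply continuous_const

lemma hasCompactSupport_partialDeriv {φ : EuclideanSpace ℝ (Fin n) → ℂ} (hφ : φ ∈ testSpace Ω)
    (k : Fin n) : HasCompactSupport (partialDeriv k φ) :=
  HasCompactSupport.fderiv_apply ℝ hφ.2.1 (EuclideanSpace.single k 1)

lemma memLp_testSpace (φ : testSpace Ω) :
    MemLp ((testSpace Ω).subtype φ) 2 (volume.restrict Ω) :=
  (φ.2.1.continuous.memLp_of_hasCompactSupport φ.2.2.1).restrict Ω

lemma memLp_testSpace_of_isRadonIn (hV : IsRadonIn Ω V) (φ : testSpace Ω) :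
    MemLp ((testSpace Ω).subtype φ) 2 (V.restrict Ω) := by
  refine (memLp_two_iff_integrable_sq_norm φ.2.1.continuous.aestronglyMeasurable).mpr ?_
  refine (integrable_mul hV φ.2 φ.2).norm.congr (Eventually.of_forall fun x => ?_)
  simp only [norm_mul, RCLike.norm_conj, sq]

/-- The partial derivative, as a linear map on test functions. -/
def partialDerivLinearMap (Ω : Set (EuclideanSpace ℝ (Fin n))) (k : Fin n) :
    testSpace Ω →ₗ[ℂ] (EuclideanSpace ℝ (Fin n) → ℂ) where
  toFun φ := partialDeriv k φ
  map_add' φ ψ := partialDeriv_add φ.2 ψ.2 k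
  map_smul' c φ := partialDeriv_smul φ.2 c k

lemma memLp_partialDeriv (k : Fin n) (φ : testSpace Ω) :
    MemLp (partialDerivLinearMap Ω k φ) 2 (volume.restrict Ω) :=
  ((continuous_partialDeriv φ.2 k).memLp_of_hasCompactSupport
    (hasCompactSupport_partialDeriv φ.2 k)).restrict Ω

/-- The inclusion of the test functions in `L₂(Ω)`. -/
def testToL2 (Ω : Set (EuclideanSpace ℝ (Fin n))) : testSpace Ω →ₗ[ℂ] L2 Ω :=
  lpLinearMap (testSpace Ω).subtype memLp_testSpace

/-- The Hilbert space of pairs of a square integrable vector field and an element of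
`L₂(Ω, V)`. -/
abbrev FieldSpace (Ω : Set (EuclideanSpace ℝ (Fin n)))
    (V : Measure (EuclideanSpace ℝ (Fin n))) : Type :=
  WithLp 2 (PiLp 2 (fun _ : Fin n => L2 Ω) × Lp ℂ 2 (V.restrict Ω))

/-- The map `φ ↦ (∇φ, φ)`, whose squared norm is the form `Q`. -/
def testToField (hV : IsRadonIn Ω V) : testSpace Ω →ₗ[ℂ] FieldSpace Ω V :=
  (WithLp.linearEquiv 2 ℂ _).symm.toLinearMap ∘ₗ
    (((WithLp.linearEquiv 2 ℂ (Fin n → L2 Ω)).symm.toLinearMap ∘ₗ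
      LinearMap.pi fun k => lpLinearMap (partialDerivLinearMap Ω k) (memLp_partialDeriv k)).prod
      (lpLinearMap (testSpace Ω).subtype (memLp_testSpace_of_isRadonIn hV)))

lemma inner_testToField (hV : IsRadonIn Ω V) (φ ψ : testSpace Ω) :
    inner ℂ (testToField hV ψ) (testToField hV φ) = form Ω V φ ψ := by
  rw [WithLp.prod_inner_apply, PiLp.inner_apply, form]
  congr 1
  · exact Finset.sum_congr rfl fun k _ =>
      inner_lpLinearMap (memLp_partialDeriv k) (memLp_partialDeriv k) ψ φ
  · exact inner_lpLinearMap (memLp_testSpace_of_isRadonIn hV) (memLp_testSpace_of_isRadonIn hV) ψ φ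

lemma formApprox_iff (hV : IsRadonIn Ω V) {φ : ℕ → testSpace Ω} {u : L2 Ω} :
    FormApprox Ω V (fun j => φ j) u ↔
      CauchySeq (fun j => testToField hV (φ j)) ∧
        Tendsto (fun j => testToL2 Ω (φ j)) atTop (𝓝 u) := by
  have h1 : Tendsto (fun p : ℕ × ℕ =>
      (form Ω V ((φ p.1 : EuclideanSpace ℝ (Fin n) → ℂ) - φ p.2) (φ p.1 - φ p.2)).re) atTop (𝓝 0) ↔
      CauchySeq (fun j => testToField hV (φ j)) := by
    rw [cauchySeq_iff_tendsto_dist_atTop_0]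
    have he : ∀ p : ℕ × ℕ,
        (form Ω V ((φ p.1 : EuclideanSpace ℝ (Fin n) → ℂ) - φ p.2) (φ p.1 - φ p.2)).re =
          dist (testToField hV (φ p.1)) (testToField hV (φ p.2)) ^ 2 := by
      intro p
      have := inner_testToField hV (φ p.1 - φ p.2) (φ p.1 - φ p.2)
      rw [inner_self_eq_norm_sq_to_K, map_sub, ← dist_eq_norm] at this
      rw [Submodule.coe_sub] at this
      rw [← this]
      norm_cast
    simp only [he]
    constructor
    · intro h
      have := h.sqrt
      simpa using this
    · intro h
      have := h.pow 2
      simpa using this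
  have h2 : Tendsto (fun j => eLpNorm ((φ j : EuclideanSpace ℝ (Fin n) → ℂ) - ⇑u) 2
      (volume.restrict Ω)) atTop (𝓝 0) ↔ Tendsto (fun j => testToL2 Ω (φ j)) atTop (𝓝 u) := by
    rw [Lp.tendsto_Lp_iff_tendsto_eLpNorm']
    refine tendsto_congr fun j => eLpNorm_congr_ae ?_
    filter_upwards [(memLp_testSpace (φ j)).coeFn_toLp] with x hx
    rw [Pi.sub_apply, Pi.sub_apply]
    exact congrArg (fun z : ℂ => z - u x) hx.symm
  exact ⟨fun h => ⟨h1.mp h.cauchy, h2.mp h.tendsto⟩,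
    fun h => ⟨fun j => (φ j).2, h1.mpr h.1, h2.mpr h.2⟩⟩

lemma mem_schrodingerGraph_iff (hV : IsRadonIn Ω V) (u f : L2 Ω) :
    (u, f) ∈ schrodingerGraph Ω V hV ↔
      u = formResolvent (testToL2 Ω) (testToField hV) (u + f) := by
  rw [← exists_approx_iff_eq_formResolvent]
  constructor
  · rintro ⟨φ, hφ, hlim⟩
    refine ⟨fun j => ⟨φ j, hφ.mem j⟩, (formApprox_iff hV).mp hφ, fun v ψ hψ => ?_⟩
    simp only [inner_testToField]
    exact hlim v _ ((formApprox_iff hV).mpr hψ)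
  · rintro ⟨φ, hφ, hlim⟩
    refine ⟨fun j => φ j, (formApprox_iff hV).mpr hφ, fun v ψ hψ => ?_⟩
    have := hlim v (fun j => ⟨ψ j, hψ.mem j⟩) ((formApprox_iff hV).mp hψ)
    simpa only [inner_testToField] using this

/-- The test functions are dense in `L₂(Ω)`. -/
lemma eq_zero_of_inner_testToL2 (hΩ : IsOpen Ω) (g : L2 Ω)
    (hg : ∀ ψ : testSpace Ω, inner ℂ (testToL2 Ω ψ) g = 0) : g = 0 := by
  refine (Lp.eq_zero_iff_ae_eq_zero).mpr ?_
  rw [EventuallyEq, ae_restrict_iff' hΩ.measurableSet]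
  refine hΩ.ae_eq_zero_of_integral_contDiff_smul_eq_zero
    (locallyIntegrableOn_of_locallyIntegrable_restrict
      ((Lp.memLp g).locallyIntegrable (by norm_num))) fun η hη hηc hηs => ?_
  have hsupp : Function.support (fun x => (η x : ℂ)) = Function.support η := by
    ext x
    simp
  have hm : (fun x => (η x : ℂ)) ∈ testSpace Ω := by
    refine ⟨Complex.ofRealCLM.contDiff.comp hη, hηc.comp_left Complex.ofReal_zero, ?_⟩
    rw [tsupport, hsupp]
    exact hηs
  have h1 := hg ⟨_, hm⟩
  rw [testToL2, inner_lpLinearMap_left] at h1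
  rw [← setIntegral_eq_integral_of_forall_compl_eq_zero (s := Ω), ← h1]
  · refine integral_congr_ae (Eventually.of_forall fun x => ?_)
    simp [mul_comm]
  · intro x hx
    rw [image_eq_zero_of_notMem_tsupport fun h => hx (hηs h), zero_smul]

/-- `(H_V + 1)⁻¹ = J J*`. The density of the test functions makes the graph that defines `H_V`
single valued. -/
lemma isShiftedInverse_schrodingerOperator (hΩ : IsOpen Ω) (hV : IsRadonIn Ω V) :
    IsShiftedInverse (formResolvent (testToL2 Ω) (testToField hV))
      (schrodingerOperator Ω V hV) := by
  intro u f
  rw [← mem_schrodingerGraph_iff, schrodingerOperator, Submodule.toLinearPMap_graph_eq]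
  rintro ⟨v, g⟩ h (rfl : v = 0)
  rw [mem_schrodingerGraph_iff, zero_add] at h
  exact eq_zero_of_formResolvent_eq_zero (eq_zero_of_inner_testToL2 hΩ) h.symm

end DirichletForm

/-! ### Plane waves -/

section Gauge

variable {n : ℕ}

/-- The plane wave `exp(i t x_k)`. -/
def planeWave (k : Fin n) (t : ℝ) (x : EuclideanSpace ℝ (Fin n)) : ℂ :=
  Complex.exp ((t * x k : ℝ) * Complex.I)

lemma norm_planeWave (k : Fin n) (t : ℝ) (x : EuclideanSpace ℝ (Fin n)) :
    ‖planeWave k t x‖ = 1 :=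
  Complex.norm_exp_ofReal_mul_I _

lemma conj_planeWave (k : Fin n) (t : ℝ) (x : EuclideanSpace ℝ (Fin n)) :
    conj (planeWave k t x) = planeWave k (-t) x := by
  rw [planeWave, ← Complex.exp_conj, planeWave]
  congr 1
  simp

lemma planeWave_neg_mul (k : Fin n) (t : ℝ) (x : EuclideanSpace ℝ (Fin n)) :
    planeWave k (-t) x * planeWave k t x = 1 := by
  rw [planeWave, planeWave, ← Complex.exp_add]
  simp

lemma hasFDerivAt_planeWave (k : Fin n) (t : ℝ) (x : EuclideanSpace ℝ (Fin n)) :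
    HasFDerivAt (planeWave k t)
      (planeWave k t x • ((t * Complex.I : ℂ) • Complex.ofRealCLM.comp
        (EuclideanSpace.proj k : EuclideanSpace ℝ (Fin n) →L[ℝ] ℝ))) x := by
  have h1 : HasFDerivAt (fun y : EuclideanSpace ℝ (Fin n) => (t * Complex.I : ℂ) * (y k : ℂ))
      ((t * Complex.I : ℂ) • Complex.ofRealCLM.comp
        (EuclideanSpace.proj k : EuclideanSpace ℝ (Fin n) →L[ℝ] ℝ)) x :=
    (Complex.ofRealCLM.comp
      (EuclideanSpace.proj k : EuclideanSpace ℝ (Fin n) →L[ℝ] ℝ)).hasFDerivAt.const_mul _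
  have h2 := h1.cexp
  have h3 : (fun y : EuclideanSpace ℝ (Fin n) => Complex.exp ((t * Complex.I : ℂ) * (y k : ℂ))) =
      planeWave k t := by
    funext y
    rw [planeWave]
    congr 1
    push_cast
    ring
  rw [h3] at h2
  rwa [congrFun h3 x] at h2

lemma contDiff_planeWave (k : Fin n) (t : ℝ) : ContDiff ℝ ∞ (planeWave k t) := by
  unfold planeWave
  have : ContDiff ℝ ∞ fun x : EuclideanSpace ℝ (Fin n) => ((t * x k : ℝ) : ℂ) :=
    Complex.ofRealCLM.contDiff.comp (contDiff_const.mul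
      (EuclideanSpace.proj k : EuclideanSpace ℝ (Fin n) →L[ℝ] ℝ).contDiff)
  exact (this.mul contDiff_const).cexp

variable {Ω : Set (EuclideanSpace ℝ (Fin n))} {V : Measure (EuclideanSpace ℝ (Fin n))}

/-- Multiplication by a plane wave on the test functions. -/
def gaugeTest (Ω : Set (EuclideanSpace ℝ (Fin n))) (k : Fin n) (t : ℝ) :
    testSpace Ω →ₗ[ℂ] testSpace Ω where
  toFun φ := ⟨fun x => planeWave k t x * φ.1 x, (contDiff_planeWave k t).mul φ.2.1,
    φ.2.2.1.mul_left, (tsupport_mul_subset_right).trans φ.2.2.2⟩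
  map_add' φ ψ := by
    ext x
    exact mul_add _ _ _
  map_smul' c φ := by
    ext x
    exact mul_left_comm _ _ _

lemma partialDeriv_gaugeTest (k j : Fin n) (t : ℝ) (φ : testSpace Ω)
    (x : EuclideanSpace ℝ (Fin n)) :
    partialDeriv j (gaugeTest Ω k t φ) x = planeWave k t x * (partialDeriv j φ x +
      if j = k then t * Complex.I * φ.1 x else 0) := by
  have hφ : DifferentiableAt ℝ φ.1 x := φ.2.1.differentiable (by simp) x
  have h := (hasFDerivAt_planeWave k t x).mul hφ.hasFDerivAt
  have h2 : partialDeriv j (gaugeTest Ω k t φ) x = _ :=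
    congrArg (fun L : EuclideanSpace ℝ (Fin n) →L[ℝ] ℂ => L (EuclideanSpace.single j 1)) h.fderiv
  rw [h2]
  simp only [partialDeriv, add_apply, smul_apply, ContinuousLinearMap.comp_apply,
    PiLp.proj_apply, Complex.ofRealCLM_apply, smul_eq_mul, PiLp.single_apply]
  by_cases hjk : j = k
  · simp [hjk]
    ring
  · simp [hjk, Ne.symm hjk]

lemma memLp_planeWave_mul (k : Fin n) (t : ℝ) (u : L2 Ω) :
    MemLp (fun x => planeWave k t x * u x) 2 (volume.restrict Ω) :=
  (memLp_congr_norm ((contDiff_planeWave k t).continuous.aestronglyMeasurable.mul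
    (Lp.aestronglyMeasurable u)) (Lp.aestronglyMeasurable u)
    (Eventually.of_forall fun x => by simp [norm_planeWave])).mpr (Lp.memLp u)

/-- Multiplication by a plane wave on `L₂(Ω)`. -/
def gaugeL2 (Ω : Set (EuclideanSpace ℝ (Fin n))) (k : Fin n) (t : ℝ) : L2 Ω →L[ℂ] L2 Ω :=
  LinearMap.mkContinuous
    { toFun := fun u => (memLp_planeWave_mul k t u).toLp _
      map_add' := fun u v => by
        rw [← MemLp.toLp_add]
        refine MemLp.toLp_congr _ _ ?_
        filter_upwards [Lp.coeFn_add u v] with x hx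
        simp only [hx, Pi.add_apply, mul_add]
      map_smul' := fun c u => by
        rw [RingHom.id_apply, ← MemLp.toLp_const_smul]
        refine MemLp.toLp_congr _ _ ?_
        filter_upwards [Lp.coeFn_smul c u] with x hx
        simp only [hx, Pi.smul_apply, smul_eq_mul]
        ring } 1 fun u => by
    rw [one_mul]
    refine Lp.norm_le_norm_of_ae_le ?_
    filter_upwards [(memLp_planeWave_mul k t u).coeFn_toLp] with x hx
    refine (congrArg norm hx).le.trans ?_
    simp [norm_planeWave]

lemma coeFn_gaugeL2 (k : Fin n) (t : ℝ) (u : L2 Ω) :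
    gaugeL2 Ω k t u =ᵐ[volume.restrict Ω] fun x => planeWave k t x * u x :=
  (memLp_planeWave_mul k t u).coeFn_toLp

lemma norm_gaugeL2 (k : Fin n) (t : ℝ) (u : L2 Ω) : ‖gaugeL2 Ω k t u‖ = ‖u‖ := by
  refine le_antisymm (Lp.norm_le_norm_of_ae_le ?_) (Lp.norm_le_norm_of_ae_le ?_) <;>
  · filter_upwards [coeFn_gaugeL2 k t u] with x hx
    simp [hx, norm_planeWave]

lemma testToL2_gaugeTest (k : Fin n) (t : ℝ) (φ : testSpace Ω) :
    testToL2 Ω (gaugeTest Ω k t φ) = gaugeL2 Ω k t (testToL2 Ω φ) := by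
  refine Lp.ext ?_
  filter_upwards [coeFn_gaugeL2 k t (testToL2 Ω φ), (memLp_testSpace φ).coeFn_toLp,
    (memLp_testSpace (gaugeTest Ω k t φ)).coeFn_toLp] with x h1 h2 h3
  rw [h1]
  refine Eq.trans h3 ?_
  exact congrArg (fun z => planeWave k t x * z) h2.symm

lemma inner_testToL2_gaugeTest (k : Fin n) (t : ℝ) (ψ : testSpace Ω) (f : L2 Ω) :
    inner ℂ (testToL2 Ω (gaugeTest Ω k (-t) ψ)) f =
      inner ℂ (testToL2 Ω ψ) (gaugeL2 Ω k t f) := by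
  rw [testToL2, inner_lpLinearMap_left, inner_lpLinearMap_left]
  refine integral_congr_ae ?_
  filter_upwards [coeFn_gaugeL2 k t f] with x hx
  rw [hx]
  change f x * conj (planeWave k (-t) x * ψ.1 x) = planeWave k t x * f x * conj (ψ.1 x)
  rw [map_mul, conj_planeWave, neg_neg]
  ring

lemma gaugeTest_neg_gaugeTest (k : Fin n) (t : ℝ) (φ : testSpace Ω) :
    gaugeTest Ω k (-t) (gaugeTest Ω k t φ) = φ := by
  ext x
  change planeWave k (-t) x * (planeWave k t x * φ.1 x) = φ.1 x
  rw [← mul_assoc, planeWave_neg_mul, one_mul]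

/-- Integration by parts for two test functions. -/
lemma integral_mul_conj_partialDeriv (k : Fin n) (φ ψ : testSpace Ω) :
    ∫ x in Ω, φ.1 x * conj (partialDeriv k ψ x) =
      -∫ x in Ω, partialDeriv k φ x * conj (ψ.1 x) := by
  have hφ0 : ∀ x ∉ Ω, φ.1 x = 0 := fun x hx =>
    image_eq_zero_of_notMem_tsupport fun h => hx (φ.2.2.2 h)
  have hψ0 : ∀ x ∉ Ω, ψ.1 x = 0 := fun x hx =>
    image_eq_zero_of_notMem_tsupport fun h => hx (ψ.2.2.2 h)
  rw [setIntegral_eq_integral_of_forall_compl_eq_zero fun x hx => by rw [hφ0 x hx, zero_mul],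
    setIntegral_eq_integral_of_forall_compl_eq_zero fun x hx => by
      rw [hψ0 x hx, map_zero, mul_zero]]
  have hdψ : Differentiable ℝ ψ.1 := ψ.2.1.differentiable (by simp)
  have hdφ : Differentiable ℝ φ.1 := φ.2.1.differentiable (by simp)
  have hconj : ∀ x, fderiv ℝ (fun y => conj (ψ.1 y)) x (EuclideanSpace.single k 1) =
      conj (partialDeriv k ψ x) := by
    intro x
    have := (Complex.conjCLE.toContinuousLinearMap.hasFDerivAt.comp x (hdψ x).hasFDerivAt).fderiv
    exact congrArg (fun L : EuclideanSpace ℝ (Fin n) →L[ℝ] ℂ => L (EuclideanSpace.single k 1)) this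
  have hcψ : Continuous fun x => conj (ψ.1 x) :=
    Complex.continuous_conj.comp ψ.2.1.continuous
  have h := integral_mul_fderiv_eq_neg_fderiv_mul_of_integrable (μ := volume) (f := φ.1)
    (g := fun y => conj (ψ.1 y)) (v := EuclideanSpace.single k 1) ?_ ?_ ?_
    (fun x _ => hdφ x) (fun x _ => ?_)
  · simp only [hconj] at h
    exact h
  · exact ((continuous_partialDeriv φ.2 k).mul hcψ).integrable_of_hasCompactSupport
      (hasCompactSupport_partialDeriv φ.2 k).mul_right
  · simp only [hconj]
    exact (φ.2.1.continuous.mul (Complex.continuous_conj.comp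
      (continuous_partialDeriv ψ.2 k))).integrable_of_hasCompactSupport φ.2.2.1.mul_right
  · exact (φ.2.1.continuous.mul hcψ).integrable_of_hasCompactSupport φ.2.2.1.mul_right
  · exact (Complex.conjCLE.toContinuousLinearMap.differentiableAt).comp x (hdψ x)

/-- A first order term and a constant are what a plane wave adds to the form. -/
lemma form_gaugeTest (k : Fin n) (t : ℝ) (φ ψ : testSpace Ω) :
    form Ω V (gaugeTest Ω k t φ) ψ = form Ω V φ (gaugeTest Ω k (-t) ψ)
      - 2 * Complex.I * t * (∫ x in Ω, planeWave k t x * partialDeriv k φ x * conj (ψ.1 x))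
      + t ^ 2 * ∫ x in Ω, planeWave k t x * φ.1 x * conj (ψ.1 x) := by
  have hV' : ∫ x in Ω, (gaugeTest Ω k t φ).1 x * conj (ψ.1 x) ∂V =
      ∫ x in Ω, φ.1 x * conj ((gaugeTest Ω k (-t) ψ).1 x) ∂V := by
    refine integral_congr_ae (Eventually.of_forall fun x => ?_)
    change planeWave k t x * φ.1 x * conj (ψ.1 x) = φ.1 x * conj (planeWave k (-t) x * ψ.1 x)
    rw [map_mul, conj_planeWave, neg_neg]
    ring
  have hcont := (contDiff_planeWave k t).continuous
  have hcψ : Continuous fun x => conj (ψ.1 x) := Complex.continuous_conj.comp ψ.2.1.continuous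
  have hi1 : Integrable (fun x => planeWave k t x * partialDeriv k φ x * conj (ψ.1 x))
      (volume.restrict Ω) :=
    (((hcont.mul (continuous_partialDeriv φ.2 k)).mul hcψ).integrable_of_hasCompactSupport
      (hasCompactSupport_partialDeriv φ.2 k).mul_left.mul_right).restrict
  have hi2 : Integrable (fun x => planeWave k t x * φ.1 x * conj (ψ.1 x)) (volume.restrict Ω) :=
    (((hcont.mul φ.2.1.continuous).mul hcψ).integrable_of_hasCompactSupport
      φ.2.2.1.mul_left.mul_right).restrict
  have hi3 : Integrable (fun x => (gaugeTest Ω k t φ).1 x * conj (partialDeriv k ψ x))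
      (volume.restrict Ω) :=
    (((gaugeTest Ω k t φ).2.1.continuous.mul (Complex.continuous_conj.comp
      (continuous_partialDeriv ψ.2 k))).integrable_of_hasCompactSupport
      (gaugeTest Ω k t φ).2.2.1.mul_right).restrict
  have hsum : ∀ j, ∫ x in Ω, partialDeriv j (gaugeTest Ω k t φ) x * conj (partialDeriv j ψ x) =
      (∫ x in Ω, partialDeriv j φ x * conj (partialDeriv j (gaugeTest Ω k (-t) ψ) x)) +
        if j = k then
          - 2 * Complex.I * t * (∫ x in Ω, planeWave k t x * partialDeriv k φ x * conj (ψ.1 x))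
          + t ^ 2 * ∫ x in Ω, planeWave k t x * φ.1 x * conj (ψ.1 x) else 0 := by
    intro j
    by_cases hjk : j = k
    · subst hjk
      rw [if_pos rfl]
      have h1 : ∀ x, partialDeriv j (gaugeTest Ω j t φ) x * conj (partialDeriv j ψ x) =
          partialDeriv j φ x * conj (partialDeriv j (gaugeTest Ω j (-t) ψ) x) +
          (t * Complex.I * ((gaugeTest Ω j t φ).1 x * conj (partialDeriv j ψ x)) -
            t * Complex.I * (planeWave j t x * partialDeriv j φ x * conj (ψ.1 x))) := by
        intro x
        rw [partialDeriv_gaugeTest, partialDeriv_gaugeTest, if_pos rfl, if_pos rfl]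
        change _ = _ + (t * Complex.I * (planeWave j t x * φ.1 x * _) - _)
        simp only [map_mul, map_add, map_neg, conj_planeWave, neg_neg, Complex.conj_ofReal,
          Complex.conj_I, Complex.ofReal_neg]
        ring
      have h2 : ∫ x in Ω, partialDeriv j (gaugeTest Ω j t φ) x * conj (ψ.1 x) =
          (∫ x in Ω, planeWave j t x * partialDeriv j φ x * conj (ψ.1 x)) +
            t * Complex.I * ∫ x in Ω, planeWave j t x * φ.1 x * conj (ψ.1 x) := by
        rw [← integral_const_mul, ← integral_add hi1 (hi2.const_mul _)]
        refine integral_congr_ae (Eventually.of_forall fun x => ?_)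
        simp only [partialDeriv_gaugeTest, if_true]
        ring
      have hi4 : Integrable (fun x =>
          t * Complex.I * ((gaugeTest Ω j t φ).1 x * conj (partialDeriv j ψ x)) -
            t * Complex.I * (planeWave j t x * partialDeriv j φ x * conj (ψ.1 x)))
          (volume.restrict Ω) := (hi3.const_mul _).sub (hi1.const_mul _)
      simp only [h1]
      rw [integral_add (integrable_partialDeriv_mul φ.2 (gaugeTest Ω j (-t) ψ).2 j)
        hi4, integral_sub (hi3.const_mul _) (hi1.const_mul _), integral_const_mul, integral_const_mul,
        integral_mul_conj_partialDeriv, h2]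
      linear_combination (-(t : ℂ) ^ 2 * ∫ x in Ω, planeWave j t x * φ.1 x * conj (ψ.1 x)) *
        Complex.I_sq
    · rw [if_neg hjk, add_zero]
      refine integral_congr_ae (Eventually.of_forall fun x => ?_)
      simp only [partialDeriv_gaugeTest, if_neg hjk, add_zero, map_mul, conj_planeWave, neg_neg]
      ring
  rw [form, form, hV', Finset.sum_congr rfl fun j _ => hsum j, Finset.sum_add_distrib,
    Finset.sum_ite_eq' Finset.univ k, if_pos (Finset.mem_univ k)]
  ring

/-- The component `∂_k` of the field `(∇φ, φ)`. -/
def fieldComponent (Ω : Set (EuclideanSpace ℝ (Fin n))) (V : Measure (EuclideanSpace ℝ (Fin n)))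
    (k : Fin n) : FieldSpace Ω V →L[ℂ] L2 Ω :=
  (PiLp.proj 2 (fun _ : Fin n => L2 Ω) k).comp (WithLp.fstL 2 ℂ _ _)

lemma norm_fieldComponent_le (k : Fin n) (p : FieldSpace Ω V) : ‖fieldComponent Ω V k p‖ ≤ ‖p‖ :=
  (PiLp.norm_apply_le p.fst k).trans (WithLp.norm_fst_le _ p)

/-- Multiplication by the plane wave `exp(i t x_k)` preserves the domain of `H_V`, and
up to a first order term controlled by `√(‖u‖ ‖H_V u‖)`, `H_V - t²` acts on the product as `H_V` does
on `u`. -/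
lemma exists_gaugeL2_eq (hV : IsRadonIn Ω V) (k : Fin n) (t : ℝ) {u f : L2 Ω}
    (h : u = formResolvent (testToL2 Ω) (testToField hV) (u + f)) :
    ∃ f', gaugeL2 Ω k t u = formResolvent (testToL2 Ω) (testToField hV) (gaugeL2 Ω k t u + f') ∧
      ‖f' - (t ^ 2) • gaugeL2 Ω k t u‖ ≤ ‖f‖ + 2 * |t| * √(‖u‖ * ‖f‖) := by
  refine exists_gauge_apply (norm_gaugeL2 k t) (norm_fieldComponent_le k)
    (m := gaugeTest Ω k t) (m' := gaugeTest Ω k (-t)) (gaugeTest_neg_gaugeTest k t)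
    (testToL2_gaugeTest k t) (inner_testToL2_gaugeTest k t) (fun φ ψ => ?_) h
  rw [inner_testToField, inner_testToField, form_gaugeTest]
  congr 2
  · congr 1
    rw [testToL2, inner_lpLinearMap_left]
    refine integral_congr_ae ?_
    filter_upwards [coeFn_gaugeL2 k t (fieldComponent Ω V k (testToField hV φ)),
      (memLp_partialDeriv k φ).coeFn_toLp] with x h1 h2
    rw [h1]
    exact congrArg (fun z => planeWave k t x * z * conj (ψ.1 x)) h2.symm
  · rw [testToL2, inner_lpLinearMap_left]
    refine integral_congr_ae ?_
    filter_upwards [coeFn_gaugeL2 k t (testToL2 Ω φ), (memLp_testSpace φ).coeFn_toLp] with x h1 h2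
    rw [testToL2] at h1
    rw [h1]
    exact congrArg (fun z => planeWave k t x * z * conj (ψ.1 x)) h2.symm

end Gauge

/-! ### The essential spectrum -/

section EssentialSpectrum

variable {n : ℕ} {Ω : Set (EuclideanSpace ℝ (Fin n))} {V : Measure (EuclideanSpace ℝ (Fin n))}

/-- From a point `s` of the essential spectrum to points near `t²`: plane waves carry approximate
eigenfunctions for `s` over to ones for `t²`, with an error governed by `s` and `t`. -/
lemma exists_mem_essentialSpectrum_near_sq (hn : 1 ≤ n) (hΩ : IsOpen Ω) (hV : IsRadonIn Ω V)
    {s : ℝ} (hs0 : 0 ≤ s) (hs : (s : ℂ) ∈ essentialSpectrum (schrodingerOperator Ω V hV))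
    (t : ℝ) {ε : ℝ} (hε : 0 < ε) :
    ∃ τ : ℝ, |τ - t ^ 2| ≤ (s + ε) + 2 * |t| * √(s + ε) + ε ∧
      (τ : ℂ) ∈ essentialSpectrum (schrodingerOperator Ω V hV) := by
  set A := formResolvent (testToL2 Ω) (testToField hV) with hA
  have h := isShiftedInverse_schrodingerOperator hΩ hV
  have hsa : IsSelfAdjoint A := isPositive_formResolvent.isSelfAdjoint
  have hσ : _root_.spectrum ℝ A ⊆ Set.Icc 0 1 := spectrum_formResolvent_subset
  set k : Fin n := ⟨0, hn⟩
  obtain ⟨W, hW, hest⟩ := h.exists_subspace hsa hσ hs hε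
  have hMinj : Function.Injective (gaugeL2 Ω k t) := by
    refine (injective_iff_map_eq_zero _).mpr fun u hu => ?_
    rw [← norm_eq_zero, ← norm_gaugeL2 k t u, hu, norm_zero]
  have hAinj : Function.Injective A := (injective_iff_map_eq_zero _).mpr fun g hg =>
    eq_zero_of_formResolvent_eq_zero (eq_zero_of_inner_testToL2 hΩ) hg
  have hgauge : ∀ g ∈ W, ∃ g', A g' = gaugeL2 Ω k t (A g) ∧
      ‖g' - (1 + t ^ 2) • A g'‖ ≤ ((s + ε) + 2 * |t| * √(s + ε)) * ‖A g'‖ := by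
    intro g hg
    have hf : ‖g - A g‖ ≤ (s + ε) * ‖A g‖ := by
      have h1 : g - A g = (g - (1 + s) • A g) + s • A g := by module
      rw [h1]
      refine (norm_add_le _ _).trans ?_
      rw [norm_smul, Real.norm_of_nonneg hs0]
      linarith [show ‖g - (1 + s) • A g‖ ≤ ε * ‖A g‖ from hest g hg]
    obtain ⟨f', hf', hn'⟩ := exists_gaugeL2_eq hV k t (u := A g) (f := g - A g)
      (by rw [add_sub_cancel])
    refine ⟨gaugeL2 Ω k t (A g) + f', hf'.symm, ?_⟩
    rw [← hA] at hf'
    rw [← hf', norm_gaugeL2]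
    have h2 : gaugeL2 Ω k t (A g) + f' - (1 + t ^ 2) • gaugeL2 Ω k t (A g) =
        f' - (t ^ 2) • gaugeL2 Ω k t (A g) := by module
    rw [h2]
    refine hn'.trans ?_
    have h3 : √(‖A g‖ * ‖g - A g‖) ≤ √(s + ε) * ‖A g‖ := by
      rw [← Real.sqrt_sq (norm_nonneg (A g)), ← Real.sqrt_mul (by positivity),
        Real.sqrt_sq (norm_nonneg (A g))]
      refine Real.sqrt_le_sqrt ?_
      nlinarith [norm_nonneg (A g)]
    nlinarith [mul_le_mul_of_nonneg_left h3 (by positivity : 0 ≤ 2 * |t|)]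
  -- the vectors `(H_V + 1)(e u)`, for `u = A g` with `g` in `W`
  set W' : Submodule ℂ (L2 Ω) := ((W.map A.toLinearMap).map (gaugeL2 Ω k t).toLinearMap).comap
    A.toLinearMap with hW'
  refine h.exists_mem_essentialSpectrum hsa hσ (r := (s + ε) + 2 * |t| * √(s + ε)) (by positivity)
    (by linarith) (W := W') (fun hfin => hW ?_) ?_
  · have hmap : ∀ g : W, ∃ g' : W', A g' = gaugeL2 Ω k t (A g) := by
      rintro ⟨g, hg⟩
      obtain ⟨g', hg', -⟩ := hgauge g hg
      refine ⟨⟨g', ?_⟩, hg'⟩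
      rw [hW', Submodule.mem_comap]
      exact ⟨A g, ⟨g, hg, rfl⟩, hg'.symm⟩
    have hfin' : FiniteDimensional ℂ (W'.map A.toLinearMap) := inferInstance
    refine FiniteDimensional.of_injective (V₂ := W'.map A.toLinearMap)
      (LinearMap.codRestrict _
        (((gaugeL2 Ω k t).toLinearMap ∘ₗ A.toLinearMap) ∘ₗ W.subtype) fun g => ?_) ?_
    · obtain ⟨g', hg'⟩ := hmap g
      exact ⟨g', g'.2, hg'⟩
    · intro g₁ g₂ h12
      exact Subtype.ext (hAinj (hMinj (congrArg Subtype.val h12)))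
  · rintro g' ⟨_, ⟨g, hg, rfl⟩, hgg'⟩
    obtain ⟨g'', h1, h2⟩ := hgauge g hg
    have : g' = g'' := hAinj (hgg'.symm.trans h1.symm)
    rw [this]
    exact h2

end EssentialSpectrum

end Schrodinger

end

theorem lemma3 (n : ℕ) (hn : 1 ≤ n) (Ω : Set (EuclideanSpace ℝ (Fin n))) (hΩ : IsOpen Ω)
    (V : MeasureTheory.Measure (EuclideanSpace ℝ (Fin n)))
    (hV : Schrodinger.IsRadonIn Ω V) (hcap : Schrodinger.AbsContCapacity Ω V) :
    (¬ Schrodinger.HasPurelyDiscreteSpectrum (Schrodinger.schrodingerOperator Ω V hV) →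
      ∀ M : ℝ, ∃ t : ℝ, M < t ∧
        (t : ℂ) ∈ Schrodinger.essentialSpectrum (Schrodinger.schrodingerOperator Ω V hV)) ∧
    ((0 : ℂ) ∈ Schrodinger.essentialSpectrum (Schrodinger.schrodingerOperator Ω V hV) →
      Schrodinger.essentialSpectrum (Schrodinger.schrodingerOperator Ω V hV) =
        (fun t : ℝ => (t : ℂ)) '' Set.Ici 0) := by
  have h := Schrodinger.isShiftedInverse_schrodingerOperator hΩ hV
  have hspec := h.mem_spectrum_iff Schrodinger.isPositive_formResolvent.isSelfAdjoint
    Schrodinger.spectrum_formResolvent_subset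
  constructor
  · intro hnd M
    obtain ⟨z, hz, hzd⟩ := Set.not_subset.mp hnd
    obtain ⟨s, hs0, rfl, -⟩ := (hspec z).mp hz
    -- the interval supplied at `t` starts at `t² - 2 c t - (s + 2)`, with `c = √(s + 1)`
    set c := √(s + 1) with hc
    have hc0 : 0 ≤ c := Real.sqrt_nonneg _
    obtain ⟨τ, hτ, hm⟩ := Schrodinger.exists_mem_essentialSpectrum_near_sq hn hΩ hV hs0 ⟨hz, hzd⟩
      (2 * c + |M| + s + 3) one_pos
    refine ⟨τ, ?_, hm⟩
    rw [abs_of_nonneg (by positivity : 0 ≤ 2 * c + |M| + s + 3)] at hτ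
    have h1 := (abs_le.mp hτ).1
    have h2 := le_abs_self M
    have h3 := abs_nonneg M
    nlinarith [mul_nonneg hc0 h3, mul_nonneg hc0 hs0, mul_nonneg h3 hs0]
  · intro h0
    refine Set.Subset.antisymm ?_ ?_
    · intro z hz
      obtain ⟨s, hs0, rfl, -⟩ := (hspec z).mp hz.1
      exact ⟨s, hs0, rfl⟩
    · rintro _ ⟨x, hx, rfl⟩
      have hx0 : 0 ≤ x := hx
      refine h.isClosed_essentialSpectrum.closure_subset (Metric.mem_closure_iff.mpr fun r hr => ?_)
      have hlim : Tendsto (fun ε : ℝ => (0 + ε) + 2 * |√x| * √(0 + ε) + ε) (𝓝[>] 0) (𝓝 0) := by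
        have hc : Continuous fun ε : ℝ => (0 + ε) + 2 * |√x| * √(0 + ε) + ε := by fun_prop
        have := hc.tendsto 0
        simp only [add_zero, Real.sqrt_zero, mul_zero] at this
        exact this.mono_left nhdsWithin_le_nhds
      obtain ⟨ε, hεr, hε⟩ := ((hlim.eventually (gt_mem_nhds hr)).and
        self_mem_nhdsWithin).exists
      obtain ⟨τ, hτ, hm⟩ := Schrodinger.exists_mem_essentialSpectrum_near_sq hn hΩ hV le_rfl
        (by simpa using h0) (√x) hε
      refine ⟨τ, hm, ?_⟩
      rw [Real.sq_sqrt hx0, abs_sub_comm] at hτ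
      rw [Complex.dist_eq, ← Complex.ofReal_sub, Complex.norm_real]
      exact hτ.trans_lt hεr
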